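/- **Theorem (Sobolev regularity with time derivatives).** Let $d\in\mathbb N_0$, $m\in\mathbb N$, $0<T<\infty$, and let $D\subset\mathbb R^d$ be a bounded open set (for instance a bounded domain of polyhedral type in $\mathbb R^3$). Let $H^m(D)$ be the space of $u\in L_2(D)$ with weak derivatives $D^\alpha u\in L_2(D)$ for $|\alpha|\le m$, normed by $\|u|H^m(D)\|^2=\sum_{|\alpha|\le m}\|D^\alpha u|L_2(D)\|^2$, let $\mathring H^m(D)$ be the closure of the test functions $\mathcal D(D)$ in $H^m(D)$, and let $H^{-m}(D)$ be the dual space of $\mathring H^m(D)$; $\mathring H^m(D)$ is embedded in $H^{-m}(D)$ by $u\mapsto\big(v\mapsto\int_D uv\,\mathrm dx\big)$. For a Banach space $X$ and $l\in\mathbb N_0$ let $H^l([0,T],X)$ be the space of $u\in L_2([0,T],X)$ whose weak derivatives $\partial_{t^k}u$, $k\le l$, lie in $L_2([0,T],X)$, normed by $\big(\sum_{k=0}^{l}\|\partial_{t^k}u|L_2([0,T],X)\|^2\big)^{1/2}$. For $l\ge 1$ put $$H^{m,l*}(D_T)=H^{l-1}([0,T],\mathring H^m(D))\cap H^{l}([0,T],H^{-m}(D)),$$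 with norm the sum of the two norms. Let $a_{\alpha\beta}$ ($|\alpha|,|\beta|\le m$) be real-valued $C^\infty$ functions on $D_T=(0,T]\times D$ that are bounded together with each of their time derivatives. Assume that there is $c>0$ with $\sum_{|\alpha|=|\beta|=m}a_{\alpha\beta}(t,x)\xi^\alpha\xi^\beta\ge c|\xi|^{2m}$ for all $(t,x)\in D_T$, $\xi\in\mathbb R^d$, and that for some $\mu>0$ the bilinear form $$B(t,u,v)=\sum_{|\alpha|,|\beta|\le m}\int_D a_{\alpha\beta}(t,x)\,(D^\beta u)(x)\,(D^\alpha v)(x)\,\mathrm dx$$ satisfies $B(t,u,u)\ge\mu\|u|H^m(D)\|^2$ for a.e. $t\in[0,T]$ and all $u\in\mathring H^m(D)$. For $f\in L_2([0,T],H^{-m}(D))$, a *weak solution* of the parabolic problem with right-hand side $f$, homogeneous Dirichlet boundary conditions and zero initial value is a function $u\in H^{m,1*}(D_T)$ with $u(0)=0$ (for its continuous $H^{-m}(D)$-valued representative) and $$\langle\partial_t u(t),v\rangle+B(t,u(t),v)=\langle f(t),v\rangle\qquad\text{for a.e. }t\in[0,T]\text{ and all }v\in\mathring H^m(D).$$ (No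 symmetry of the coefficients is required. In particular this covers the weak form of $\partial_t u+(-1)^m\sum_{|\alpha|,|\beta|\le m}D^\alpha(\tilde a_{\alpha\beta}D^\beta u)=f$, with $a_{\alpha\beta}=(-1)^{m+|\alpha|}\tilde a_{\alpha\beta}$, provided these $a_{\alpha\beta}$ satisfy the assumptions above.) Let $l\in\mathbb N_0$. Then there is a constant $C>0$ such that for every $$f\in H^l([0,T],H^{-m}(D))\quad\text{with}\quad \partial_{t^k}f(0)=0\quad\text{for }k=0,\dots,l-1$$ (in the sense of continuous $H^{-m}(D)$-valued representatives) there is exactly one weak solution $u\in H^{m,1*}(D_T)$, this $u$ belongs to $H^{m,(l+1)*}(D_T)$, it satisfies $\partial_{t^k}u\in H^{m,1*}(D_T)$ for $k=0,\dots,l$, and $$\sum_{k=0}^{l}\|\partial_{t^k}u|H^{m,1*}(D_T)\|\le C\sum_{k=0}^{l}\|\partial_{t^k}f|L_2([0,T],H^{-m}(D))\|.$$ -/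

import Mathlib

open MeasureTheory Set
open scoped ContDiff RealInnerProductSpace

noncomputable section

namespace ParabolicSobolev

/-! Sobolev spaces on an open set `D` of `ℝ^d` -/

/-- Multi-indices `α ∈ ℕ₀^d` with `|α| ≤ m`. -/
abbrev MultiIndex (d m : ℕ) : Type := {α : Fin d → Fin (m + 1) // ∑ i, (α i : ℕ) ≤ m}

/-- The order `|α|` of a multi-index. -/
def MultiIndex.order {d m : ℕ} (α : MultiIndex d m) : ℕ := ∑ i, (α.1 i : ℕ)

/-- The monomial `ξ^α`. -/
def MultiIndex.monomial {d m : ℕ} (α : MultiIndex d m) (ξ : EuclideanSpace ℝ (Fin d)) : ℝ :=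
  ∏ i, ξ i ^ (α.1 i : ℕ)

/-- The multi-index `0`. -/
def MultiIndex.zero (d m : ℕ) : MultiIndex d m := ⟨fun _ => 0, by simp⟩

/-- The classical partial derivative `∂φ/∂x_i`. -/
def pderiv {d : ℕ} (i : Fin d) (φ : EuclideanSpace ℝ (Fin d) → ℝ) :
    EuclideanSpace ℝ (Fin d) → ℝ :=
  fun x => fderiv ℝ φ x (EuclideanSpace.single i 1)

/-- The classical derivative `D^α φ = ∂_1^{α_1} ⋯ ∂_d^{α_d} φ`. -/
def classicalDeriv {d m : ℕ} (α : MultiIndex d m) (φ : EuclideanSpace ℝ (Fin d) → ℝ) :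
    EuclideanSpace ℝ (Fin d) → ℝ :=
  (List.finRange d).foldr (fun i g => (pderiv i)^[(α.1 i : ℕ)] g) φ

/-- Test functions: smooth functions with compact support contained in `D`. -/
structure IsTestFunction {E : Type*} [NormedAddCommGroup E] [NormedSpace ℝ E]
    (D : Set E) (φ : E → ℝ) : Prop where
  smooth : ContDiff ℝ ∞ φ
  compact : HasCompactSupport φ
  support : tsupport φ ⊆ D

/-- `L_2(D)`. -/
abbrev L2 {d : ℕ} (D : Set (EuclideanSpace ℝ (Fin d))) : Type := Lp ℝ 2 (volume.restrict D)

/-- `w = D^α u` in the weak sense on `D`. -/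
def IsWeakDeriv {d m : ℕ} (D : Set (EuclideanSpace ℝ (Fin d))) (α : MultiIndex d m)
    (u w : L2 D) : Prop :=
  ∀ φ : EuclideanSpace ℝ (Fin d) → ℝ, IsTestFunction D φ →
    ∫ x in D, w x * φ x = (-1) ^ α.order * ∫ x in D, u x * classicalDeriv α φ x

theorem pderiv_smooth {d : ℕ} (i : Fin d) {φ : EuclideanSpace ℝ (Fin d) → ℝ}
    (h : ContDiff ℝ ∞ φ ∧ HasCompactSupport φ) :
    ContDiff ℝ ∞ (pderiv i φ) ∧ HasCompactSupport (pderiv i φ) := by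
  refine ⟨?_, ?_⟩
  · exact (h.1.fderiv_right (m := ∞) (by simp)).clm_apply contDiff_const
  · exact h.2.fderiv_apply (𝕜 := ℝ) _

theorem classicalDeriv_smooth {d m : ℕ} (α : MultiIndex d m)
    {φ : EuclideanSpace ℝ (Fin d) → ℝ} (h : ContDiff ℝ ∞ φ ∧ HasCompactSupport φ) :
    ContDiff ℝ ∞ (classicalDeriv α φ) ∧ HasCompactSupport (classicalDeriv α φ) := by
  unfold classicalDeriv
  induction List.finRange d with
  | nil => exact h
  | cons i t ih =>
    simp only [List.foldr_cons]
    induction (α.1 i : ℕ) with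
    | zero => exact ih
    | succ n ihn =>
      rw [Function.iterate_succ_apply']
      exact pderiv_smooth i ihn

theorem memLp_of_test {d : ℕ} (D : Set (EuclideanSpace ℝ (Fin d)))
    {φ : EuclideanSpace ℝ (Fin d) → ℝ} (h : ContDiff ℝ ∞ φ ∧ HasCompactSupport φ) :
    MemLp φ 2 (volume.restrict D) :=
  h.1.continuous.memLp_of_hasCompactSupport h.2

theorem integral_eq_inner {d : ℕ} (D : Set (EuclideanSpace ℝ (Fin d)))
    {φ : EuclideanSpace ℝ (Fin d) → ℝ} (h : MemLp φ 2 (volume.restrict D)) (u : L2 D) :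
    ∫ x in D, u x * φ x = inner ℝ u (h.toLp φ) := by
  rw [L2.inner_def]
  refine integral_congr_ae ?_
  filter_upwards [h.coeFn_toLp] with x hx
  simp [hx, mul_comm]

theorem isWeakDeriv_iff {d m : ℕ} (D : Set (EuclideanSpace ℝ (Fin d))) (α : MultiIndex d m)
    (u w : L2 D) : IsWeakDeriv D α u w ↔
      ∀ (φ : EuclideanSpace ℝ (Fin d) → ℝ) (h : IsTestFunction D φ),
        inner ℝ w ((memLp_of_test D ⟨h.smooth, h.compact⟩).toLp φ) = (-1) ^ α.order *
          inner ℝ u ((memLp_of_test D (classicalDeriv_smooth α ⟨h.smooth, h.compact⟩)).toLp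
            (classicalDeriv α φ)) := by
  refine forall_congr' fun φ => forall_congr' fun h => ?_
  rw [← integral_eq_inner, ← integral_eq_inner]

/-- `H^m(D)`: a function `u ∈ L_2(D)` together with its weak derivatives `D^α u ∈ L_2(D)`,
`|α| ≤ m`, with the norm `(∑_{|α| ≤ m} ‖D^α u‖²)^{1/2}`. The function itself is the component
with index `0`. -/
def SobolevSpace {d : ℕ} (D : Set (EuclideanSpace ℝ (Fin d))) (m : ℕ) :
    Submodule ℝ (PiLp 2 fun _ : MultiIndex d m => L2 D) where
  carrier := {U | ∀ α, IsWeakDeriv D α (U (MultiIndex.zero d m)) (U α)}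
  add_mem' := by
    intro U V hU hV α
    have hU := (isWeakDeriv_iff D α _ _).1 (hU α)
    have hV := (isWeakDeriv_iff D α _ _).1 (hV α)
    rw [isWeakDeriv_iff]
    intro φ h
    simp only [PiLp.add_apply, inner_add_left, hU φ h, hV φ h, mul_add]
  zero_mem' := by
    intro α
    rw [isWeakDeriv_iff]
    intro φ h
    simp
  smul_mem' := by
    intro c U hU α
    have hU := (isWeakDeriv_iff D α _ _).1 (hU α)
    rw [isWeakDeriv_iff]
    intro φ h
    simp only [PiLp.smul_apply, real_inner_smul_left, hU φ h]
    ring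

theorem isClosed_sobolevSpace {d : ℕ} (D : Set (EuclideanSpace ℝ (Fin d))) (m : ℕ) :
    IsClosed (SobolevSpace D m : Set (PiLp 2 fun _ : MultiIndex d m => L2 D)) := by
  have : (SobolevSpace D m : Set (PiLp 2 fun _ : MultiIndex d m => L2 D)) =
      {U | ∀ α, IsWeakDeriv D α (U (MultiIndex.zero d m)) (U α)} := rfl
  rw [this]
  simp only [isWeakDeriv_iff, ofPred_forall]
  refine isClosed_iInter fun α => isClosed_iInter fun φ => isClosed_iInter fun h => ?_
  refine isClosed_eq ?_ ?_
  · exact (PiLp.continuous_apply 2 _ α).inner continuous_const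
  · exact continuous_const.mul ((PiLp.continuous_apply 2 _ _).inner continuous_const)

instance {d : ℕ} (D : Set (EuclideanSpace ℝ (Fin d))) (m : ℕ) :
    CompleteSpace (SobolevSpace D m) :=
  (isClosed_sobolevSpace D m).completeSpace_coe

/-- The elements of `H^m(D)` that are (classes of) test functions on `D`. -/
def testSubmodule {d : ℕ} (D : Set (EuclideanSpace ℝ (Fin d))) (m : ℕ) :
    Submodule ℝ (SobolevSpace D m) where
  carrier := {U | ∃ φ, IsTestFunction D φ ∧ U.1 (MultiIndex.zero d m) =ᵐ[volume.restrict D] φ}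
  add_mem' := by
    rintro U V ⟨φ, hφ, hU⟩ ⟨ψ, hψ, hV⟩
    refine ⟨φ + ψ, ⟨hφ.smooth.add hψ.smooth, hφ.compact.add hψ.compact,
      (tsupport_add φ ψ).trans (union_subset hφ.support hψ.support)⟩, ?_⟩
    exact (Lp.coeFn_add _ _).trans (hU.add hV)
  zero_mem' := ⟨0, ⟨contDiff_const, HasCompactSupport.zero, by simp [tsupport]⟩,
    Lp.coeFn_zero _ _ _⟩
  smul_mem' := by
    rintro c U ⟨φ, hφ, hU⟩
    refine ⟨c • φ, ⟨contDiff_const.smul hφ.smooth, hφ.compact.smul_left,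
      (closure_mono (Function.support_const_smul_subset c φ)).trans hφ.support⟩, ?_⟩
    exact (Lp.coeFn_smul _ _).trans (hU.const_smul c)

/-- `H̊^m(D)`: the closure of the test functions in `H^m(D)`, with the norm of `H^m(D)`. -/
def SobolevZero {d : ℕ} (D : Set (EuclideanSpace ℝ (Fin d))) (m : ℕ) : Type :=
  (testSubmodule D m).topologicalClosure

section Instances

variable {d : ℕ} (D : Set (EuclideanSpace ℝ (Fin d))) (m : ℕ)

instance : NormedAddCommGroup (SobolevZero D m) :=
  (testSubmodule D m).topologicalClosure.normedAddCommGroup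

instance : InnerProductSpace ℝ (SobolevZero D m) :=
  (testSubmodule D m).topologicalClosure.innerProductSpace

instance : CompleteSpace (SobolevZero D m) :=
  Submodule.topologicalClosure.completeSpace (testSubmodule D m)

end Instances

/-- The inclusion of `H̊^m(D)` in `H^m(D)`. -/
def SobolevZero.incl {d : ℕ} (D : Set (EuclideanSpace ℝ (Fin d))) (m : ℕ) :
    SobolevZero D m →L[ℝ] SobolevSpace D m :=
  (testSubmodule D m).topologicalClosure.subtypeL

/-- The weak derivative `D^α u` of `u ∈ H̊^m(D)`. -/
def SobolevZero.weakDeriv {d m : ℕ} {D : Set (EuclideanSpace ℝ (Fin d))}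
    (α : MultiIndex d m) : SobolevZero D m →L[ℝ] L2 D :=
  (PiLp.proj 2 (fun _ : MultiIndex d m => L2 D) α).comp
    ((SobolevSpace D m).subtypeL.comp (SobolevZero.incl D m))

/-- `H^{-m}(D)`: the dual space of `H̊^m(D)`, with the dual norm. -/
abbrev SobolevNeg {d : ℕ} (D : Set (EuclideanSpace ℝ (Fin d))) (m : ℕ) : Type :=
  StrongDual ℝ (SobolevZero D m)

/-- The embedding `H̊^m(D) → H^{-m}(D)`, `u ↦ (v ↦ ∫_D u v)`. -/
def toNeg {d : ℕ} (D : Set (EuclideanSpace ℝ (Fin d))) (m : ℕ) :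
    SobolevZero D m →L[ℝ] SobolevNeg D m :=
  LinearMap.mkContinuous₂
    ((innerₗ (L2 D)).compl₁₂ (SobolevZero.weakDeriv (MultiIndex.zero d m)).toLinearMap
      (SobolevZero.weakDeriv (MultiIndex.zero d m)).toLinearMap)
    (‖(SobolevZero.weakDeriv (MultiIndex.zero d m) : SobolevZero D m →L[ℝ] L2 D)‖ *
      ‖(SobolevZero.weakDeriv (MultiIndex.zero d m) : SobolevZero D m →L[ℝ] L2 D)‖)
    (by
      intro u v
      change ‖inner ℝ (SobolevZero.weakDeriv (MultiIndex.zero d m) u)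
        (SobolevZero.weakDeriv (MultiIndex.zero d m) v)‖ ≤ _
      refine (norm_inner_le_norm _ _).trans ?_
      refine (mul_le_mul (ContinuousLinearMap.le_opNorm _ u) (ContinuousLinearMap.le_opNorm _ v)
        (norm_nonneg _) (by positivity)).trans (le_of_eq (by ring)))

theorem toNeg_apply {d m : ℕ} (D : Set (EuclideanSpace ℝ (Fin d))) (u v : SobolevZero D m) :
    toNeg D m u v = ∫ x in D, SobolevZero.weakDeriv (MultiIndex.zero d m) u x *
      SobolevZero.weakDeriv (MultiIndex.zero d m) v x := by
  change inner ℝ (SobolevZero.weakDeriv (MultiIndex.zero d m) u)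
    (SobolevZero.weakDeriv (MultiIndex.zero d m) v) = _
  rw [L2.inner_def]
  simp [mul_comm]

/-! Sobolev spaces of functions on `[0,T]` with values in a Banach space `X` -/

/-- `L_2([0,T], X)`. -/
abbrev TimeL2 (T : ℝ) (X : Type*) [NormedAddCommGroup X] : Type _ :=
  Lp X 2 (volume.restrict (Icc 0 T))

section Time

variable {T : ℝ} {X : Type*} [NormedAddCommGroup X] [NormedSpace ℝ X] [CompleteSpace X]

/-- `w = ∂_{t^k} u` in the weak sense on `(0,T)`. -/
def IsWeakTimeDeriv (k : ℕ) (u w : TimeL2 T X) : Prop :=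
  ∀ φ : ℝ → ℝ, IsTestFunction (Ioo 0 T) φ →
    ∫ t in Icc 0 T, φ t • w t = (-1 : ℝ) ^ k • ∫ t in Icc 0 T, iteratedDeriv k φ t • u t

open Classical in
/-- The weak derivative `∂_{t^k} u ∈ L_2([0,T], X)`; the value is `0` if there is none. -/
def timeDeriv (k : ℕ) (u : TimeL2 T X) : TimeL2 T X :=
  if h : ∃ w : TimeL2 T X, IsWeakTimeDeriv k u w then h.choose else 0

/-- `u ∈ H^l([0,T], X)`: the weak derivatives up to order `l` exist in `L_2([0,T], X)`. -/
def MemTimeSobolev (l : ℕ) (u : TimeL2 T X) : Prop :=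
  ∀ k ≤ l, ∃ w : TimeL2 T X, IsWeakTimeDeriv k u w

/-- The norm of `H^l([0,T], X)`. -/
def timeSobolevNorm (l : ℕ) (u : TimeL2 T X) : ℝ :=
  √(∑ k ∈ Finset.range (l + 1), ‖timeDeriv k u‖ ^ 2)

/-- `u(0) = 0`: the class `u` has a representative that is continuous on `[0,T]` and vanishes
at `0`. -/
def VanishesAtZero (u : TimeL2 T X) : Prop :=
  ∃ c : ℝ → X, ContinuousOn c (Icc 0 T) ∧ u =ᵐ[volume.restrict (Icc 0 T)] c ∧ c 0 = 0

end Time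

/-- `u ∈ L_2([0,T], H̊^m(D))` regarded as an element of `L_2([0,T], H^{-m}(D))`. -/
def timeToNeg {d m : ℕ} {D : Set (EuclideanSpace ℝ (Fin d))} {T : ℝ}
    (u : TimeL2 T (SobolevZero D m)) : TimeL2 T (SobolevNeg D m) :=
  (toNeg D m).compLp u

/-- `u ∈ H^{m,l*}(D_T) = H^{l-1}([0,T], H̊^m(D)) ∩ H^l([0,T], H^{-m}(D))`, for `l ≥ 1`. -/
def MemParabolic {d m : ℕ} {D : Set (EuclideanSpace ℝ (Fin d))} {T : ℝ} (l : ℕ)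
    (u : TimeL2 T (SobolevZero D m)) : Prop :=
  MemTimeSobolev (l - 1) u ∧ MemTimeSobolev l (timeToNeg u)

/-- The norm of `H^{m,l*}(D_T)`, for `l ≥ 1`. -/
def parabolicNorm {d m : ℕ} {D : Set (EuclideanSpace ℝ (Fin d))} {T : ℝ} (l : ℕ)
    (u : TimeL2 T (SobolevZero D m)) : ℝ :=
  timeSobolevNorm (l - 1) u + timeSobolevNorm l (timeToNeg u)

/-! The parabolic problem -/

/-- Families `(a_{αβ})_{|α|, |β| ≤ m}` of functions of `(t, x)`. -/
abbrev Coefficients (d m : ℕ) : Type :=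
  MultiIndex d m → MultiIndex d m → ℝ × EuclideanSpace ℝ (Fin d) → ℝ

/-- `B(t,u,v) = ∑_{|α|, |β| ≤ m} ∫_D a_{αβ}(t,x) D^β u(x) D^α v(x) dx`. -/
def bilinForm {d m : ℕ} {D : Set (EuclideanSpace ℝ (Fin d))} (a : Coefficients d m) (t : ℝ)
    (u v : SobolevZero D m) : ℝ :=
  ∑ α, ∑ β, ∫ x in D, a α β (t, x) * SobolevZero.weakDeriv β u x * SobolevZero.weakDeriv α v x

/-- The assumptions on the coefficients. No symmetry between `a_{αβ}` and `a_{βα}` is imposed;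
hence the coefficients may absorb the signs `(-1)^{m+|α|}` that integration by parts produces when
the form `B` is derived from `(-1)^m ∑ D^α (a_{αβ} D^β ·)`. -/
structure IsParabolic {d m : ℕ} (D : Set (EuclideanSpace ℝ (Fin d))) (T : ℝ)
    (a : Coefficients d m) : Prop where
  smooth : ∀ α β, ContDiffOn ℝ ∞ (a α β) (Ioc 0 T ×ˢ D)
  /-- The coefficients and all their time derivatives are bounded on `(0,T] × D`. -/
  bounded : ∀ α β (k : ℕ), ∃ M : ℝ, ∀ t ∈ Ioc 0 T, ∀ x ∈ D,
    |iteratedDerivWithin k (fun s => a α β (s, x)) (Ioc 0 T) t| ≤ M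
  elliptic : ∃ c > 0, ∀ t ∈ Ioc 0 T, ∀ x ∈ D, ∀ ξ : EuclideanSpace ℝ (Fin d),
    c * ‖ξ‖ ^ (2 * m) ≤ ∑ α : MultiIndex d m, ∑ β : MultiIndex d m,
      if α.order = m ∧ β.order = m then a α β (t, x) * α.monomial ξ * β.monomial ξ else 0
  coercive : ∃ μ > 0, ∀ᵐ t ∂(volume.restrict (Icc 0 T)), ∀ u : SobolevZero D m,
    μ * ‖u‖ ^ 2 ≤ bilinForm a t u u

/-- `u` is a weak solution in `H^{m,1*}(D_T)` of the parabolic problem with right-hand side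
`f ∈ L_2([0,T], H^{-m}(D))`: `u(0) = 0` and, for almost every `t ∈ [0,T]`,
`⟨∂_t u(t), v⟩ + B(t, u(t), v) = ⟨f(t), v⟩` for all `v ∈ H̊^m(D)`. -/
structure IsWeakSolution {d m : ℕ} {D : Set (EuclideanSpace ℝ (Fin d))} {T : ℝ}
    (a : Coefficients d m) (f : TimeL2 T (SobolevNeg D m)) (u : TimeL2 T (SobolevZero D m)) :
    Prop where
  mem : MemParabolic 1 u
  initial : VanishesAtZero (timeToNeg u)
  equation : ∀ᵐ t ∂(volume.restrict (Icc 0 T)), ∀ v : SobolevZero D m,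
    timeDeriv 1 (timeToNeg u) t v + bilinForm a t (u t) v = f t v

end ParabolicSobolev

end

/-! Let `V = H̊^m(D)` and let `J` be integration from `0` on `L_2([0,T], X)`. The compatibility
conditions say that `f = J^l f_l` with `f_l = ∂_t^l f` (`timeDeriv_eq_prim_pow`), so the solution is
sought in the form `u = J^l v`. Through the Riesz isomorphism of `V` the form `B(t,·,·)` becomes an
operator `A(t)` and the `L_2(D)` inner product becomes an operator `G`; equation and initial
condition together read `G u = J(f - A u)`. Differentiated `l` times this is `G v = J(f_l - L v)`,
where `L v = ∂_t^l (A J^l v)` is `A v` plus memory terms in which derivatives of `A` act on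
primitives of `v` (`leibnizOp`).

In the norm weighted by `e^{-ct}` the operator `J` has norm at most `1/c`. For large `c` the memory
terms are therefore absorbed by the coercivity of `A`, and `L` is coercive
(`IsSmoothCoercive.coercive_leibnizOp`). Solvability follows by duality: monotonicity of `d/dt` with
zero initial value and coercivity of `L` bound `J†ψ` by `(G + J L)†ψ`, so every `J g` lies in the
range of `G + J L`, with a norm bound on the preimage (`exists_solution`).

Since `J^l L = A J^l` (`IsSmoothCoercive.prim_pow_leibnizOp`), integrating `l` times returns the
original equation. Thus `J^l v` is a weak solution whose time derivatives are the functions `J^(l-k)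
v`, and all of them are controlled by the single estimate for `v`. Uniqueness is a weighted energy
argument for the primitive of the difference of two solutions
(`IsSmoothCoercive.eq_zero_of_homogeneous`). -/

noncomputable section

set_option linter.unusedSectionVars false

namespace ParabolicSobolev

/-! Multiplication operators between `L_2` spaces -/

section Multiplication

variable {Ω : Type*} [MeasurableSpace Ω] {μ : Measure Ω}
variable {X Y Z : Type*} [NormedAddCommGroup X] [NormedSpace ℝ X]
  [NormedAddCommGroup Y] [NormedSpace ℝ Y] [NormedAddCommGroup Z] [NormedSpace ℝ Z]

open Classical in
/-- The multiplication operator `u ↦ (t ↦ B t (u t))` of an essentially bounded operator-valued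
function `B`. -/
def lpMul (B : Ω → X →L[ℝ] Y) : Lp X 2 μ →L[ℝ] Lp Y 2 μ :=
  if h : MemLp B ⊤ μ then (ContinuousLinearMap.id ℝ (X →L[ℝ] Y)).holderL μ ⊤ 2 2 (h.toLp B) else 0

theorem coeFn_lpMul {B : Ω → X →L[ℝ] Y} (h : MemLp B ⊤ μ) (u : Lp X 2 μ) :
    lpMul B u =ᵐ[μ] fun t => B t (u t) := by
  rw [lpMul, dif_pos h]
  filter_upwards [(ContinuousLinearMap.id ℝ (X →L[ℝ] Y)).coeFn_holder (r := 2) (h.toLp B) u,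
    h.coeFn_toLp] with t h1 h2
  rw [← h2]
  exact h1

theorem norm_lpMul_apply_le (B : Ω → X →L[ℝ] Y) {C : ℝ} (hC : 0 ≤ C)
    (hB : ∀ᵐ t ∂μ, ‖B t‖ ≤ C) (u : Lp X 2 μ) : ‖lpMul B u‖ ≤ C * ‖u‖ := by
  by_cases h : MemLp B ⊤ μ
  · refine Lp.norm_le_mul_norm_of_ae_le_mul ?_
    filter_upwards [coeFn_lpMul h u, hB] with t h1 h2
    rw [h1]
    exact ((B t).le_opNorm _).trans (by gcongr)
  -- Without measurability of `B` the operator is `0` by default, and the bound is trivial.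
  · rw [lpMul, dif_neg h]
    simpa using by positivity

theorem lpMul_const (L : X →L[ℝ] Y) (u : Lp X 2 μ) : lpMul (fun _ => L) u = L.compLp u := by
  apply Lp.ext
  filter_upwards [coeFn_lpMul (memLp_top_const L) u, L.coeFn_compLp u] with t h1 h2
  rw [h1, h2]

theorem memLp_smul_id {w : Ω → ℝ} (hw : MemLp w ⊤ μ) :
    MemLp (fun t => w t • ContinuousLinearMap.id ℝ X) ⊤ μ := by
  refine MemLp.of_le_mul (c := ‖ContinuousLinearMap.id ℝ X‖) hw (hw.1.smul_const _) ?_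
  filter_upwards with t
  rw [norm_smul, mul_comm]

end Multiplication

/-! The primitive of a function in `L_2([0,T], X)` -/

section Primitive

variable {T : ℝ} {X Y : Type*} [NormedAddCommGroup X] [NormedSpace ℝ X] [CompleteSpace X]
  [NormedAddCommGroup Y] [NormedSpace ℝ Y] [CompleteSpace Y]

theorem TimeL2.integrableOn (u : TimeL2 T X) : IntegrableOn u (Icc 0 T) :=
  (Lp.memLp u).integrable (by norm_num)

theorem TimeL2.intervalIntegrable (u : TimeL2 T X) {s t : ℝ} (hs : s ∈ Icc 0 T)
    (ht : t ∈ Icc 0 T) : IntervalIntegrable u volume s t := by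
  refine (u.integrableOn.mono_set ?_).intervalIntegrable
  exact uIcc_subset_Icc hs ht

theorem ae_Ioo (T : ℝ) : ∀ᵐ t ∂(volume.restrict (Icc 0 T)), t ∈ Ioo 0 T := by
  rw [← restrict_Ioo_eq_restrict_Icc]
  exact ae_restrict_mem measurableSet_Ioo

theorem integral_congr_timeL2 {u v : ℝ → X} (h : u =ᵐ[volume.restrict (Icc 0 T)] v) {s t : ℝ}
    (hs : s ∈ Icc 0 T) (ht : t ∈ Icc 0 T) : ∫ r in s..t, u r = ∫ r in s..t, v r := by
  refine intervalIntegral.integral_congr_ae_restrict ?_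
  exact ae_restrict_of_ae_restrict_of_subset (uIoc_subset_uIcc.trans (uIcc_subset_Icc hs ht)) h

theorem continuousOn_prim (u : TimeL2 T X) :
    ContinuousOn (fun t => ∫ s in (0:ℝ)..t, u s) (Icc 0 T) := by
  rcases le_or_gt 0 T with hT | hT
  · have := intervalIntegral.continuousOn_primitive_interval (f := u) (a := 0) (b := T) (μ := volume)
    rw [uIcc_of_le hT] at this
    exact this u.integrableOn
  · simp [Icc_eq_empty_of_lt hT]

/-- Hölder's inequality on an interval of length `T`; the bound is uniform in `t`, which makes `J`
bounded on `L_2`. -/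
theorem norm_prim_le (u : TimeL2 T X) {t : ℝ} (ht : t ∈ Icc 0 T) :
    ‖∫ s in (0:ℝ)..t, u s‖ ≤ √T * ‖u‖ := by
  have h1 : ‖∫ s in (0:ℝ)..t, u s‖ ≤ ∫ s in Icc 0 T, ‖u s‖ := by
    refine (intervalIntegral.norm_integral_le_integral_norm ht.1).trans ?_
    rw [intervalIntegral.integral_of_le ht.1]
    refine setIntegral_mono_set u.integrableOn.norm (by filter_upwards with s using norm_nonneg _) ?_
    exact (Ioc_subset_Icc_self.trans (Icc_subset_Icc_right ht.2)).eventuallyLE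
  have hT : 0 ≤ T := ht.1.trans ht.2
  have h2 := eLpNorm_le_eLpNorm_mul_rpow_measure_univ (p := 1) (q := 2) (by norm_num)
    (Lp.aestronglyMeasurable u)
  rw [integral_norm_eq_lintegral_enorm (Lp.aestronglyMeasurable u),
    ← eLpNorm_one_eq_lintegral_enorm] at h1
  refine h1.trans ?_
  rw [Lp.norm_def, ← ENNReal.toReal_ofReal (Real.sqrt_nonneg T), ← ENNReal.toReal_mul]
  refine ENNReal.toReal_mono (ENNReal.mul_ne_top ENNReal.ofReal_ne_top (Lp.eLpNorm_ne_top u)) ?_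
  refine h2.trans (le_of_eq ?_)
  rw [mul_comm]
  congr 1
  rw [Measure.restrict_apply_univ, Real.volume_Icc, sub_zero, Real.sqrt_eq_rpow,
    ENNReal.ofReal_rpow_of_nonneg hT (by norm_num)]
  norm_num

theorem memLp_prim (u : TimeL2 T X) :
    MemLp (fun t => ∫ s in (0:ℝ)..t, u s) 2 (volume.restrict (Icc 0 T)) := by
  refine MemLp.of_bound ((continuousOn_prim u).aestronglyMeasurable measurableSet_Icc) (√T * ‖u‖) ?_
  filter_upwards [ae_Ioo T] with t ht using norm_prim_le u (Ioo_subset_Icc_self ht)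

/-- `(J u)(t) = ∫_0^t u`. -/
def prim (T : ℝ) (X : Type*) [NormedAddCommGroup X] [NormedSpace ℝ X] [CompleteSpace X] :
    TimeL2 T X →L[ℝ] TimeL2 T X :=
  LinearMap.mkContinuous
    { toFun := fun u => (memLp_prim u).toLp _
      map_add' := by
        intro u v
        apply Lp.ext
        filter_upwards [(memLp_prim (u + v)).coeFn_toLp, (memLp_prim u).coeFn_toLp,
          (memLp_prim v).coeFn_toLp,
          Lp.coeFn_add ((memLp_prim u).toLp _) ((memLp_prim v).toLp _), ae_Ioo T] with t h1 h2 h3 h4 h5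
        have h0 : (0:ℝ) ∈ Icc 0 T := ⟨le_rfl, h5.1.le.trans h5.2.le⟩
        rw [h1, h4, Pi.add_apply, h2, h3, ← intervalIntegral.integral_add
          (u.intervalIntegrable h0 (Ioo_subset_Icc_self h5))
          (v.intervalIntegrable h0 (Ioo_subset_Icc_self h5))]
        exact integral_congr_timeL2 (Lp.coeFn_add u v) h0 (Ioo_subset_Icc_self h5)
      map_smul' := by
        intro c u
        apply Lp.ext
        filter_upwards [(memLp_prim (c • u)).coeFn_toLp, (memLp_prim u).coeFn_toLp,
          Lp.coeFn_smul c ((memLp_prim u).toLp _), ae_Ioo T] with t h1 h2 h4 h5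
        rw [h1, RingHom.id_apply, h4, Pi.smul_apply, h2, ← intervalIntegral.integral_smul]
        exact integral_congr_timeL2 (Lp.coeFn_smul c u) ⟨le_rfl, h5.1.le.trans h5.2.le⟩
          (Ioo_subset_Icc_self h5) }
    (measureUnivNNReal (volume.restrict (Icc 0 T)) ^ (2 : ENNReal).toReal⁻¹ * √T) (by
      intro u
      rw [mul_assoc]
      refine Lp.norm_le_of_ae_bound (by positivity) ?_
      filter_upwards [(memLp_prim u).coeFn_toLp, ae_Ioo T] with t h1 h2
      exact (congrArg norm h1).trans_le (norm_prim_le u (Ioo_subset_Icc_self h2)))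

theorem coeFn_prim (u : TimeL2 T X) :
    prim T X u =ᵐ[volume.restrict (Icc 0 T)] fun t => ∫ s in (0:ℝ)..t, u s :=
  (memLp_prim u).coeFn_toLp

theorem prim_compLp (L : X →L[ℝ] Y) (u : TimeL2 T X) :
    prim T Y (L.compLp u) = L.compLp (prim T X u) := by
  apply Lp.ext
  filter_upwards [coeFn_prim u, coeFn_prim (L.compLp u), L.coeFn_compLp (prim T X u), ae_Ioo T]
    with t h1 h2 h3 h5
  have h0 : (0:ℝ) ∈ Icc 0 T := ⟨le_rfl, h5.1.le.trans h5.2.le⟩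
  have ht := Ioo_subset_Icc_self h5
  rw [h2, h3, h1, ← L.intervalIntegral_comp_comm (u.intervalIntegrable h0 ht)]
  exact integral_congr_timeL2 (L.coeFn_compLp u) h0 ht

/-- Bounded continuous functions are dense in `L_2`. Identities and inequalities that are continuous
in `u` thereby reduce to integrands whose primitives are differentiable at every point. -/
theorem timeL2_induction {p : TimeL2 T X → Prop} (hp : IsClosed {u | p u})
    (h : ∀ u : TimeL2 T X, (∃ c : ℝ → X, Continuous c ∧ u =ᵐ[volume.restrict (Icc 0 T)] c) → p u)
    (u : TimeL2 T X) : p u := by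
  have hd := BoundedContinuousFunction.toLp_denseRange X ℝ (μ := volume.restrict (Icc 0 T)) (p := 2)
    (by norm_num)
  refine hp.closure_subset_iff.2 ?_ (hd u)
  rintro _ ⟨c, rfl⟩
  exact h _ ⟨c, c.continuous, BoundedContinuousFunction.coeFn_toLp _ _ _ c⟩

theorem integral_inner_timeL2 {X : Type*} [NormedAddCommGroup X] [InnerProductSpace ℝ X]
    {f g : ℝ → X} {u v : TimeL2 T X} (hT : 0 ≤ T)
    (hu : u =ᵐ[volume.restrict (Icc 0 T)] f) (hv : v =ᵐ[volume.restrict (Icc 0 T)] g) :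
    inner ℝ u v = ∫ t in (0:ℝ)..T, inner ℝ (f t) (g t) := by
  rw [L2.inner_def, intervalIntegral.integral_of_le hT, ← integral_Icc_eq_integral_Ioc]
  refine integral_congr_ae ?_
  filter_upwards [hu, hv] with t h1 h2
  rw [h1, h2]

theorem prim_hasDerivAt {c : ℝ → X} (hc : Continuous c) (t : ℝ) :
    HasDerivAt (fun t => ∫ s in (0:ℝ)..t, c s) (c t) t :=
  intervalIntegral.integral_hasDerivAt_right (hc.intervalIntegrable _ _)
    (hc.stronglyMeasurableAtFilter _ _) hc.continuousAt

theorem coeFn_prim_of_ae_eq {u : TimeL2 T X} {c : ℝ → X}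
    (h : u =ᵐ[volume.restrict (Icc 0 T)] c) :
    prim T X u =ᵐ[volume.restrict (Icc 0 T)] fun t => ∫ s in (0:ℝ)..t, c s := by
  filter_upwards [coeFn_prim u, ae_Ioo T] with t h1 h2
  rw [h1]
  exact integral_congr_timeL2 h ⟨le_rfl, h2.1.le.trans h2.2.le⟩ (Ioo_subset_Icc_self h2)

/-- Leibniz' rule `A · Ju = J (A' · Ju + A · u)` in integrated form. -/
theorem lpMul_prim {A A' : ℝ → X →L[ℝ] Y} (hA : MemLp A ⊤ (volume.restrict (Icc 0 T)))
    (hA' : MemLp A' ⊤ (volume.restrict (Icc 0 T))) {C : ℝ} (hC : ∀ t ∈ Ioo 0 T, ‖A t‖ ≤ C)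
    (hd : ∀ t ∈ Ioo 0 T, HasDerivAt A (A' t) t) (u : TimeL2 T X) :
    lpMul A (prim T X u) = prim T Y (lpMul A' (prim T X u) + lpMul A u) := by
  refine timeL2_induction (p := fun u => lpMul A (prim T X u) =
    prim T Y (lpMul A' (prim T X u) + lpMul A u)) ?_ ?_ u
  · exact isClosed_eq (by fun_prop) (by fun_prop)
  rintro u ⟨c, hc, hu⟩
  have hJ := coeFn_prim_of_ae_eq hu
  set F : ℝ → X := fun t => ∫ s in (0:ℝ)..t, c s with hF
  have hFd : ∀ t, HasDerivAt F (c t) t := prim_hasDerivAt hc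
  have hFc : Continuous F := continuous_iff_continuousAt.2 fun t => (hFd t).continuousAt
  have hF0 : F 0 = 0 := by simp [hF]
  have hg : (lpMul A' (prim T X u) + lpMul A u : TimeL2 T Y) =ᵐ[volume.restrict (Icc 0 T)]
      fun t => A' t (F t) + A t (c t) := by
    filter_upwards [Lp.coeFn_add (lpMul A' (prim T X u)) (lpMul A u), coeFn_lpMul hA' (prim T X u),
      coeFn_lpMul hA u, hu, hJ] with t h1 h2 h3 h4 h5
    rw [h1, Pi.add_apply, h2, h3, h4, h5]
  apply Lp.ext
  filter_upwards [coeFn_lpMul hA (prim T X u), hJ, coeFn_prim_of_ae_eq hg, ae_Ioo T]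
    with t h1 h2 h3 h4
  rw [h1, h2, h3]
  have hder : ∀ s ∈ Ioo 0 T, HasDerivAt (fun s => A s (F s)) (A' s (F s) + A s (c s)) s :=
    fun s hs => (hd s hs).clm_apply (hFd s)
  -- Nothing is assumed about `A` as `s → 0`; continuity at `0` comes from the bound `C` together
  -- with `F 0 = 0`.
  have hcont : ContinuousOn (fun s => A s (F s)) (Icc 0 t) := by
    intro s hs
    rcases hs.1.eq_or_lt with rfl | hs0
    · rw [ContinuousWithinAt, hF0, map_zero]
      refine squeeze_zero_norm' (a := fun s => C * ‖F s‖) ?_ ?_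
      · filter_upwards [self_mem_nhdsWithin] with r hr
        rcases hr.1.eq_or_lt with rfl | hr0
        · simp [hF0]
        · exact ((A r).le_opNorm _).trans
            (mul_le_mul_of_nonneg_right (hC r ⟨hr0, hr.2.trans_lt h4.2⟩) (norm_nonneg _))
      · have : Continuous fun s => C * ‖F s‖ := by fun_prop
        simpa [hF0] using (this.tendsto 0).mono_left nhdsWithin_le_nhds
    · exact (hder s ⟨hs0, hs.2.trans_lt h4.2⟩).continuousAt.continuousWithinAt
  have hint : IntegrableOn (fun s => A' s (F s) + A s (c s)) (Icc 0 T) :=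
    (TimeL2.integrableOn _).congr hg
  rw [intervalIntegral.integral_eq_sub_of_hasDerivAt_of_le h4.1.le hcont
    (fun s hs => hder s ⟨hs.1, hs.2.trans h4.2⟩), hF0, map_zero, sub_zero]
  exact (intervalIntegrable_iff_integrableOn_Icc_of_le h4.1.le).2
    (hint.mono_set (Icc_subset_Icc_right h4.2.le))

end Primitive

/-! Exponential weights -/

section Weight

variable {T : ℝ} {X Y : Type*} [NormedAddCommGroup X] [NormedSpace ℝ X] [CompleteSpace X]
  [NormedAddCommGroup Y] [NormedSpace ℝ Y] [CompleteSpace Y]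

theorem exp_mul_le (c : ℝ) {t : ℝ} (ht : t ∈ Icc 0 T) :
    Real.exp (c * t) ≤ Real.exp (|c| * T) := by
  gcongr
  · exact ht.1
  · exact le_abs_self c
  · exact ht.2

theorem memLp_exp (T c : ℝ) :
    MemLp (fun t : ℝ => Real.exp (c * t)) ⊤ (volume.restrict (Icc 0 T)) := by
  refine memLp_top_of_bound (by fun_prop) (Real.exp (|c| * T)) ?_
  filter_upwards [ae_Ioo T] with t ht
  rw [Real.norm_of_nonneg (Real.exp_pos _).le]
  exact exp_mul_le c (Ioo_subset_Icc_self ht)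

/-- Multiplication by `e^{ct}`. -/
def expWeight (T c : ℝ) (X : Type*) [NormedAddCommGroup X] [NormedSpace ℝ X] :
    TimeL2 T X →L[ℝ] TimeL2 T X :=
  lpMul fun t => Real.exp (c * t) • ContinuousLinearMap.id ℝ X

theorem coeFn_expWeight (c : ℝ) (u : TimeL2 T X) :
    expWeight T c X u =ᵐ[volume.restrict (Icc 0 T)] fun t => Real.exp (c * t) • u t :=
  coeFn_lpMul (memLp_smul_id (memLp_exp T c)) u

theorem norm_expWeight_le (c : ℝ) (u : TimeL2 T X) :
    ‖expWeight T c X u‖ ≤ Real.exp (|c| * T) * ‖u‖ := by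
  refine Lp.norm_le_mul_norm_of_ae_le_mul ?_
  filter_upwards [coeFn_expWeight c u, ae_Ioo T] with t h1 h2
  rw [h1, norm_smul, Real.norm_of_nonneg (Real.exp_pos _).le]
  exact mul_le_mul_of_nonneg_right (exp_mul_le c (Ioo_subset_Icc_self h2)) (norm_nonneg _)

theorem expWeight_add (b c : ℝ) (u : TimeL2 T X) :
    expWeight T b X (expWeight T c X u) = expWeight T (b + c) X u := by
  apply Lp.ext
  filter_upwards [coeFn_expWeight b (expWeight T c X u), coeFn_expWeight c u,
    coeFn_expWeight (b + c) u] with t h1 h2 h3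
  rw [h1, h2, h3, smul_smul, ← Real.exp_add, add_mul]

theorem expWeight_zero (u : TimeL2 T X) : expWeight T 0 X u = u := by
  apply Lp.ext
  filter_upwards [coeFn_expWeight 0 u] with t h1
  simp [h1]

theorem norm_le_expWeight (c : ℝ) (u : TimeL2 T X) :
    ‖u‖ ≤ Real.exp (|c| * T) * ‖expWeight T c X u‖ := by
  have := norm_expWeight_le (-c) (expWeight T c X u)
  rwa [expWeight_add, neg_add_cancel, expWeight_zero, abs_neg] at this

theorem expWeight_lpMul (c : ℝ) {B : ℝ → X →L[ℝ] Y} (hB : MemLp B ⊤ (volume.restrict (Icc 0 T)))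
    (u : TimeL2 T X) :
    expWeight T c Y (lpMul B u) = lpMul B (expWeight T c X u) := by
  apply Lp.ext
  have h1 := coeFn_expWeight c (lpMul B u : TimeL2 T Y)
  filter_upwards [h1, coeFn_expWeight c u, coeFn_lpMul hB u,
    coeFn_lpMul hB (expWeight T c X u)] with t h1 h2 h3 h4
  rw [h1, h4, h2, h3, map_smul]

theorem expWeight_compLp (c : ℝ) (L : X →L[ℝ] Y) (u : TimeL2 T X) :
    expWeight T c Y (L.compLp u) = L.compLp (expWeight T c X u) := by
  rw [← lpMul_const, ← lpMul_const, expWeight_lpMul c (memLp_top_const L)]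

variable {H : Type*} [NormedAddCommGroup H] [InnerProductSpace ℝ H] [CompleteSpace H]

theorem inner_expWeight (c : ℝ) (u v : TimeL2 T H) :
    inner ℝ (expWeight T c H u) v = inner ℝ u (expWeight T c H v) := by
  rw [L2.inner_def, L2.inner_def]
  refine integral_congr_ae ?_
  filter_upwards [coeFn_expWeight c u, coeFn_expWeight c v] with t h1 h2
  rw [h1, h2, inner_smul_left, inner_smul_right]
  rfl

/-- The integral over `[0,T]` of `d/dt (e^{-2ct} ‖Ju‖² / 2)` is nonnegative. -/
theorem mul_norm_sq_expWeight_prim_le (hT : 0 ≤ T) (c : ℝ) (u : TimeL2 T H) :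
    c * ‖expWeight T (-c) H (prim T H u)‖ ^ 2 ≤
      inner ℝ (expWeight T (-c) H u) (expWeight T (-c) H (prim T H u)) := by
  refine timeL2_induction (p := fun u => c * ‖expWeight T (-c) H (prim T H u)‖ ^ 2 ≤
      inner ℝ (expWeight T (-c) H u) (expWeight T (-c) H (prim T H u))) ?_ ?_ u
  · exact isClosed_le (by fun_prop) (by fun_prop)
  rintro u ⟨k, hk, hu⟩
  have hJ := coeFn_prim_of_ae_eq hu
  set F : ℝ → H := fun t => ∫ s in (0:ℝ)..t, k s with hF
  have hFd : ∀ t, HasDerivAt F (k t) t := prim_hasDerivAt hk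
  have hFc : Continuous F := continuous_iff_continuousAt.2 fun t => (hFd t).continuousAt
  have hF0 : F 0 = 0 := by simp [hF]
  have h1 : expWeight T (-c) H u =ᵐ[volume.restrict (Icc 0 T)]
      fun t => Real.exp (-c * t) • k t := by
    filter_upwards [coeFn_expWeight (-c) u, hu] with t h1 h2
    rw [h1, h2]
  have h2 : expWeight T (-c) H (prim T H u) =ᵐ[volume.restrict (Icc 0 T)]
      fun t => Real.exp (-c * t) • F t := by
    filter_upwards [coeFn_expWeight (-c) (prim T H u), hJ] with t h1 h2
    rw [h1, h2]
  have hE : ∀ t, HasDerivAt (fun t => Real.exp (-c * t) • F t)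
      (Real.exp (-c * t) • k t - c • Real.exp (-c * t) • F t) t := by
    intro t
    have := (((hasDerivAt_id t).const_mul (-c)).exp).fun_smul (hFd t)
    convert! this using 1
    simp only [id, smul_smul, mul_one, sub_eq_add_neg, ← neg_smul]
    congr 2
    ring
  have hcE : Continuous fun t => Real.exp (-c * t) • F t := by fun_prop
  have hint := intervalIntegral.integral_eq_sub_of_hasDerivAt (a := 0) (b := T)
    (fun t _ => (hE t).norm_sq) (Continuous.intervalIntegrable (by fun_prop) _ _)
  -- The integral equals `‖e^{-cT} F(T)‖²`, because the boundary term at `0` vanishes.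
  have hpos : 0 ≤ ∫ t in (0:ℝ)..T, 2 * inner ℝ (Real.exp (-c * t) • F t)
      (Real.exp (-c * t) • k t - c • Real.exp (-c * t) • F t) := by
    rw [hint]
    simp [hF0]
  rw [← real_inner_self_eq_norm_sq, integral_inner_timeL2 hT h1 h2, integral_inner_timeL2 hT h2 h2,
    ← sub_nonneg, ← intervalIntegral.integral_const_mul, ← intervalIntegral.integral_sub
      (Continuous.intervalIntegrable (by fun_prop) _ _)
      (Continuous.intervalIntegrable (by fun_prop) _ _)]
  rw [intervalIntegral.integral_const_mul] at hpos
  refine (nonneg_of_mul_nonneg_right hpos two_pos).trans_eq ?_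
  refine intervalIntegral.integral_congr fun t _ => ?_
  simp only [inner_sub_right, real_inner_smul_right, real_inner_comm]

theorem inner_prim_nonneg (hT : 0 ≤ T) {c : ℝ} (hc : 0 ≤ c) (u : TimeL2 T H) :
    0 ≤ inner ℝ (expWeight T (-c) H u) (expWeight T (-c) H (prim T H u)) :=
  (by positivity : 0 ≤ c * ‖expWeight T (-c) H (prim T H u)‖ ^ 2).trans
    (mul_norm_sq_expWeight_prim_le hT c u)

/-- Cauchy–Schwarz applied to the preceding energy inequality. The gain of `1/c` in the weighted
norm is what makes every term containing a primitive small. -/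
theorem mul_norm_expWeight_prim_le (hT : 0 ≤ T) (c : ℝ) (u : TimeL2 T H) :
    c * ‖expWeight T (-c) H (prim T H u)‖ ≤ ‖expWeight T (-c) H u‖ := by
  have h := (mul_norm_sq_expWeight_prim_le hT c u).trans (real_inner_le_norm _ _)
  rcases (norm_nonneg (expWeight T (-c) H (prim T H u))).eq_or_lt with h0 | h0
  · rw [← h0, mul_zero]
    exact norm_nonneg _
  · rw [pow_two, ← mul_assoc] at h
    exact le_of_mul_le_mul_right h h0

end Weight

/-! Weak time derivatives and primitives -/

section WeakDerivative

variable {T : ℝ} {X Y : Type*} [NormedAddCommGroup X] [NormedSpace ℝ X] [CompleteSpace X]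
  [NormedAddCommGroup Y] [NormedSpace ℝ Y] [CompleteSpace Y]

theorem IsTestFunction.deriv {D : Set ℝ} {φ : ℝ → ℝ} (h : IsTestFunction D φ) :
    IsTestFunction D (deriv φ) where
  smooth := (contDiff_infty_iff_deriv.1 h.smooth).2
  compact := h.compact.deriv
  support := tsupport_deriv_subset.trans h.support

theorem IsTestFunction.iteratedDeriv {D : Set ℝ} {φ : ℝ → ℝ} (h : IsTestFunction D φ) (k : ℕ) :
    IsTestFunction D (iteratedDeriv k φ) := by
  induction k with
  | zero => simpa using h
  | succ k ih =>
    rw [iteratedDeriv_succ]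
    exact ih.deriv

theorem IsTestFunction.sub_const_mul {D : Set ℝ} {φ ψ : ℝ → ℝ} (hφ : IsTestFunction D φ)
    (hψ : IsTestFunction D ψ) (c : ℝ) : IsTestFunction D (fun t => φ t - c * ψ t) where
  smooth := hφ.smooth.sub (contDiff_const.mul hψ.smooth)
  compact := hφ.compact.sub (hψ.compact.mul_left (f := fun _ => c))
  support := (tsupport_sub φ (fun t => c * ψ t)).trans
    (union_subset hφ.support ((tsupport_mul_subset_right (f := fun _ => c)).trans hψ.support))

theorem IsTestFunction.eq_zero {D : Set ℝ} {φ : ℝ → ℝ} (h : IsTestFunction D φ) {t : ℝ}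
    (ht : t ∉ D) : φ t = 0 :=
  image_eq_zero_of_notMem_tsupport fun h' => ht (h.support h')

theorem IsTestFunction.memLp_top {D : Set ℝ} {φ : ℝ → ℝ} (h : IsTestFunction D φ)
    (μ : Measure ℝ) : MemLp φ ⊤ μ := by
  obtain ⟨C, hC⟩ := h.compact.exists_bound_of_continuous h.smooth.continuous
  exact memLp_top_of_bound h.smooth.continuous.aestronglyMeasurable C (.of_forall hC)

theorem IsTestFunction.integrable_smul {D : Set ℝ} {φ : ℝ → ℝ} (h : IsTestFunction D φ)
    (u : TimeL2 T X) : IntegrableOn (fun t => φ t • u t) (Icc 0 T) :=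
  Integrable.smul_of_top_right u.integrableOn (h.memLp_top _)

theorem eq_zero_of_integral_test_smul {u : TimeL2 T X}
    (h : ∀ φ : ℝ → ℝ, IsTestFunction (Ioo 0 T) φ → ∫ t in Icc 0 T, φ t • u t = 0) : u = 0 := by
  have h0 : ∀ᵐ t ∂(volume : Measure ℝ), t ∈ Ioo 0 T → u t = 0 := by
    refine isOpen_Ioo.ae_eq_zero_of_integral_contDiff_smul_eq_zero
      ((u.integrableOn.mono_set Ioo_subset_Icc_self).locallyIntegrableOn) fun φ h1 h2 h3 => ?_
    have hφ : IsTestFunction (Ioo 0 T) φ := ⟨h1, h2, h3⟩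
    rw [← h φ hφ, setIntegral_eq_integral_of_forall_compl_eq_zero]
    intro t ht
    rw [hφ.eq_zero fun h' => ht (Ioo_subset_Icc_self h'), zero_smul]
  apply Lp.ext
  filter_upwards [ae_restrict_of_ae h0, ae_Ioo T, Lp.coeFn_zero X 2 (volume.restrict (Icc 0 T))]
    with t h1 h2 h3
  rw [h1 h2, h3, Pi.zero_apply]

theorem integral_smul_sub {D : Set ℝ} {φ : ℝ → ℝ} (h : IsTestFunction D φ) (u v : TimeL2 T X) :
    ∫ t in Icc 0 T, φ t • (u - v) t =
      (∫ t in Icc 0 T, φ t • u t) - ∫ t in Icc 0 T, φ t • v t := by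
  rw [← integral_sub (h.integrable_smul u) (h.integrable_smul v)]
  refine integral_congr_ae ?_
  filter_upwards [Lp.coeFn_sub u v] with t ht
  rw [ht, Pi.sub_apply, smul_sub]

theorem IsWeakTimeDeriv.sub {k : ℕ} {u u' w w' : TimeL2 T X} (h : IsWeakTimeDeriv k u w)
    (h' : IsWeakTimeDeriv k u' w') : IsWeakTimeDeriv k (u - u') (w - w') := by
  intro φ hφ
  rw [integral_smul_sub hφ, integral_smul_sub (hφ.iteratedDeriv k), h φ hφ, h' φ hφ, smul_sub]

theorem IsWeakTimeDeriv.unique {k : ℕ} {u w w' : TimeL2 T X} (h : IsWeakTimeDeriv k u w)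
    (h' : IsWeakTimeDeriv k u w') : w = w' := by
  refine sub_eq_zero.1 (eq_zero_of_integral_test_smul fun φ hφ => ?_)
  rw [integral_smul_sub hφ, h φ hφ, h' φ hφ, sub_self]

theorem IsWeakTimeDeriv.timeDeriv_eq {k : ℕ} {u w : TimeL2 T X} (h : IsWeakTimeDeriv k u w) :
    timeDeriv k u = w := by
  have h' : ∃ w : TimeL2 T X, IsWeakTimeDeriv k u w := ⟨w, h⟩
  rw [timeDeriv, dif_pos h']
  exact h'.choose_spec.unique h

theorem isWeakTimeDeriv_timeDeriv {k : ℕ} {u : TimeL2 T X}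
    (h : ∃ w : TimeL2 T X, IsWeakTimeDeriv k u w) : IsWeakTimeDeriv k u (timeDeriv k u) := by
  obtain ⟨w, hw⟩ := h
  rwa [hw.timeDeriv_eq]

theorem isWeakTimeDeriv_zero (u : TimeL2 T X) : IsWeakTimeDeriv 0 u u := by
  intro φ _
  simp

theorem IsWeakTimeDeriv.comp {k : ℕ} {u v w : TimeL2 T X} (h : IsWeakTimeDeriv 1 u v)
    (h' : IsWeakTimeDeriv k v w) : IsWeakTimeDeriv (k + 1) u w := by
  intro φ hφ
  rw [h' φ hφ, h _ (hφ.iteratedDeriv k), smul_smul, ← pow_add, iteratedDeriv_one,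
    iteratedDeriv_succ]

/-- The derivative of a test function is again a test function, so the order-`k` relation may be
tested against `φ'`. -/
theorem IsWeakTimeDeriv.of_succ {k : ℕ} {u v w : TimeL2 T X} (h : IsWeakTimeDeriv k u v)
    (h' : IsWeakTimeDeriv (k + 1) u w) : IsWeakTimeDeriv 1 v w := by
  intro φ hφ
  rw [h' φ hφ, iteratedDeriv_one, h _ hφ.deriv, smul_smul, iteratedDeriv_succ', ← pow_add,
    add_comm]

/-- Continuous functions that agree almost everywhere on a nondegenerate interval agree everywhere;
this permits evaluation at the endpoints. -/
theorem prim_eqOn (hT : 0 < T) {u : TimeL2 T X} {f : ℝ → X} (hf : ContinuousOn f (Icc 0 T))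
    (h : prim T X u =ᵐ[volume.restrict (Icc 0 T)] f) {t : ℝ} (ht : t ∈ Icc 0 T) :
    f t = ∫ s in (0:ℝ)..t, u s :=
  Measure.eqOn_Icc_of_ae_eq volume hT.ne (h.symm.trans (coeFn_prim u)) hf (continuousOn_prim u) ht

theorem vanishesAtZero_prim (u : TimeL2 T X) : VanishesAtZero (prim T X u) :=
  ⟨_, continuousOn_prim u, coeFn_prim u, by simp⟩

/-- The Leibniz rule with `A = φ · id` gives `φ Ju = J(φ' Ju + φ u)`. At time `T`, where `φ`
vanishes, this is the required integration by parts. -/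
theorem isWeakTimeDeriv_prim (hT : 0 < T) (u : TimeL2 T X) :
    IsWeakTimeDeriv 1 (prim T X u) u := by
  intro φ hφ
  obtain ⟨C, hC⟩ := (hφ.compact.smul_right
    (f' := fun _ => ContinuousLinearMap.id ℝ X)).exists_bound_of_continuous
      (hφ.smooth.continuous.smul continuous_const)
  have hm := memLp_smul_id (X := X) (hφ.memLp_top (volume.restrict (Icc 0 T)))
  have hm' := memLp_smul_id (X := X) (hφ.deriv.memLp_top (volume.restrict (Icc 0 T)))
  have key := lpMul_prim hm hm' (fun t _ => hC t) (fun t _ =>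
    (hφ.smooth.differentiable (by simp) t).hasDerivAt.smul_const (ContinuousLinearMap.id ℝ X)) u
  have h1 : prim T X (lpMul (fun t => deriv φ t • ContinuousLinearMap.id ℝ X) (prim T X u) +
      lpMul (fun t => φ t • ContinuousLinearMap.id ℝ X) u) =ᵐ[volume.restrict (Icc 0 T)]
        fun t => φ t • ∫ s in (0:ℝ)..t, u s := by
    rw [← key]
    filter_upwards [coeFn_lpMul hm (prim T X u), coeFn_prim u] with t h1 h2
    rw [h1, h2]
    rfl
  have h2 := prim_eqOn hT (hφ.smooth.continuous.continuousOn.smul (continuousOn_prim u)) h1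
    (right_mem_Icc.2 hT.le)
  rw [Pi.smul_apply', hφ.eq_zero right_notMem_Ioo, zero_smul, intervalIntegral.integral_of_le hT.le,
    ← integral_Icc_eq_integral_Ioc] at h2
  rw [pow_one, neg_one_smul, iteratedDeriv_one, ← add_eq_zero_iff_eq_neg', h2,
    ← integral_add (hφ.deriv.integrable_smul _) (hφ.integrable_smul _)]
  refine integral_congr_ae ?_
  filter_upwards [Lp.coeFn_add (lpMul (fun t => deriv φ t • ContinuousLinearMap.id ℝ X) (prim T X u))
    (lpMul (fun t => φ t • ContinuousLinearMap.id ℝ X) u), coeFn_lpMul hm' (prim T X u),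
    coeFn_lpMul hm u] with t h1 h2 h3
  rw [h1, Pi.add_apply, h2, h3]
  rfl

theorem isWeakTimeDeriv_prim_iterate (hT : 0 < T) (k : ℕ) (u : TimeL2 T X) :
    IsWeakTimeDeriv k ((prim T X ^ k) u) u := by
  induction k with
  | zero => exact isWeakTimeDeriv_zero u
  | succ k ih =>
    rw [pow_succ']
    exact (isWeakTimeDeriv_prim hT _).comp ih

theorem prim_injective (hT : 0 < T) {u : TimeL2 T X} (h : prim T X u = 0) : u = 0 := by
  have h1 := isWeakTimeDeriv_prim hT u
  have h2 := isWeakTimeDeriv_prim hT (0 : TimeL2 T X)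
  rw [map_zero] at h2
  rw [h] at h1
  exact h1.unique h2

theorem exists_isTestFunction_integral_eq_one (hT : 0 < T) :
    ∃ ρ : ℝ → ℝ, IsTestFunction (Ioo 0 T) ρ ∧ ∫ t in Icc 0 T, ρ t = 1 := by
  let b : ContDiffBump (T / 2) := ⟨T / 8, T / 4, by positivity, by linarith⟩
  have hs : tsupport (b.normed volume) ⊆ Ioo 0 T := by
    rw [b.tsupport_normed_eq, Real.closedBall_eq_Icc]
    intro t ht
    have h1 : T / 2 - T / 4 ≤ t := ht.1
    have h2 : t ≤ T / 2 + T / 4 := ht.2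
    constructor <;> linarith
  have hρ : IsTestFunction (Ioo 0 T) (b.normed volume) :=
    ⟨b.contDiff_normed, b.hasCompactSupport_normed, hs⟩
  refine ⟨_, hρ, ?_⟩
  rw [setIntegral_eq_integral_of_forall_compl_eq_zero, b.integral_normed]
  intro t ht
  exact hρ.eq_zero fun h => ht (Ioo_subset_Icc_self h)

/-- A test function with vanishing integral is the derivative of a test function. -/
theorem IsTestFunction.exists_deriv_eq (hT : 0 < T) {χ : ℝ → ℝ} (h : IsTestFunction (Ioo 0 T) χ)
    (h0 : ∫ t in Icc 0 T, χ t = 0) : ∃ φ, IsTestFunction (Ioo 0 T) φ ∧ _root_.deriv φ = χ := by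
  -- The point `T / 2` keeps the set nonempty when `χ = 0`, so that it has a least and a greatest
  -- element.
  have hK : IsCompact (insert (T / 2) (tsupport χ)) := h.compact.isCompact.insert _
  have hKT : insert (T / 2) (tsupport χ) ⊆ Ioo 0 T :=
    insert_subset ⟨by positivity, by linarith⟩ h.support
  obtain ⟨a, haK, ha⟩ := hK.exists_isLeast (insert_nonempty _ _)
  obtain ⟨b, hbK, hb⟩ := hK.exists_isGreatest (insert_nonempty _ _)
  have hc := h.smooth.continuous
  have hzero : ∀ s, s ∉ Icc a b → χ s = 0 := fun s hs => image_eq_zero_of_notMem_tsupport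
    fun hs' => hs ⟨ha (mem_insert_of_mem _ hs'), hb (mem_insert_of_mem _ hs')⟩
  have hd : ∀ t, HasDerivAt (fun t => ∫ s in (0:ℝ)..t, χ s) (χ t) t := prim_hasDerivAt hc
  have hderiv : _root_.deriv (fun t => ∫ s in (0:ℝ)..t, χ s) = χ := funext fun t => (hd t).deriv
  have hsupp : Function.support (fun t => ∫ s in (0:ℝ)..t, χ s) ⊆ Icc a b := by
    intro t ht
    by_contra hn
    refine ht ?_
    rcases lt_or_ge t a with hta | hta
    · refine intervalIntegral.integral_zero_ae (.of_forall fun s hs => hzero s fun hs' => ?_)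
      rcases le_total 0 t with h1 | h1
      · rw [uIoc_of_le h1] at hs
        exact absurd (hs'.1.trans hs.2) (not_le.2 hta)
      · rw [uIoc_of_ge h1] at hs
        exact absurd ((hKT haK).1.trans_le (hs'.1.trans hs.2)) (lt_irrefl 0)
    -- To the right of the support the primitive equals the full integral of `χ`, which is zero by
    -- hypothesis.
    · have htb : b < t := by
        by_contra h'
        exact hn ⟨hta, not_lt.1 h'⟩
      have h1 : ∫ s in (0:ℝ)..T, χ s = 0 := by
        rw [intervalIntegral.integral_of_le hT.le, ← integral_Icc_eq_integral_Ioc, h0]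
      change ∫ s in (0:ℝ)..t, χ s = 0
      rw [← intervalIntegral.integral_add_adjacent_intervals (hc.intervalIntegrable 0 T)
        (hc.intervalIntegrable T t), h1, zero_add]
      refine intervalIntegral.integral_zero_ae (.of_forall fun s hs => hzero s fun hs' => ?_)
      exact absurd ((lt_min (hKT hbK).2 htb).trans (show min T t < s from hs.1)) (not_lt.2 hs'.2)
  have hts := closure_minimal hsupp isClosed_Icc
  refine ⟨_, ⟨?_, ?_, hts.trans fun t ht => ⟨(hKT haK).1.trans_le ht.1, ht.2.trans_lt (hKT hbK).2⟩⟩,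
    hderiv⟩
  · exact contDiff_infty_iff_deriv.2 ⟨fun t => (hd t).differentiableAt, hderiv.symm ▸ h.smooth⟩
  · exact isCompact_Icc.of_isClosed_subset (isClosed_tsupport _) hts

/-- The lemma of du Bois-Reymond. -/
theorem IsWeakTimeDeriv.ae_eq_const (hT : 0 < T) {z : TimeL2 T X} (h : IsWeakTimeDeriv 1 z 0) :
    ∃ c : X, z =ᵐ[volume.restrict (Icc 0 T)] fun _ => c := by
  obtain ⟨ρ, hρ, hρ1⟩ := exists_isTestFunction_integral_eq_one hT
  set c : X := ∫ t in Icc 0 T, ρ t • z t with hc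
  have hm : MemLp (fun _ : ℝ => c) 2 (volume.restrict (Icc 0 T)) := memLp_const c
  refine ⟨c, ?_⟩
  have hz : z - hm.toLp _ = 0 := by
    refine eq_zero_of_integral_test_smul fun ψ hψ => ?_
    have hψi : IntegrableOn ψ (Icc 0 T) :=
      (hψ.smooth.continuous.integrable_of_hasCompactSupport hψ.compact).integrableOn
    have hρi : IntegrableOn ρ (Icc 0 T) :=
      (hρ.smooth.continuous.integrable_of_hasCompactSupport hρ.compact).integrableOn
    -- Subtracting `(∫ψ) ρ` removes the mean of `ψ`, so the difference is some `φ'`, on which `z`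
    -- vanishes. Hence `z` acts on `ψ` like the constant `c`, its `ρ`-average.
    obtain ⟨φ, hφ, hφ'⟩ := (hψ.sub_const_mul hρ (∫ t in Icc 0 T, ψ t)).exists_deriv_eq hT (by
      rw [integral_sub hψi (hρi.const_mul _), integral_const_mul, hρ1, mul_one, sub_self])
    have h1 := h φ hφ
    rw [iteratedDeriv_one, hφ', pow_one, neg_one_smul, eq_comm, neg_eq_iff_eq_neg] at h1
    have h2 : ∫ t in Icc 0 T, φ t • (0 : TimeL2 T X) t = 0 := by
      refine integral_eq_zero_of_ae ?_
      filter_upwards [Lp.coeFn_zero X 2 (volume.restrict (Icc 0 T))] with t ht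
      rw [ht, Pi.zero_apply, smul_zero]
    rw [h2, neg_zero] at h1
    simp only [sub_smul, mul_smul] at h1
    have h3 : IntegrableOn (fun t => (∫ t in Icc 0 T, ψ t) • ρ t • z t) (Icc 0 T) :=
      (hρ.integrable_smul z).smul _
    rw [integral_sub (hψ.integrable_smul z) h3, integral_smul, ← hc] at h1
    rw [integral_smul_sub hψ, ← h1]
    congr 1
    rw [← integral_smul_const]
    refine integral_congr_ae ?_
    filter_upwards [hm.coeFn_toLp] with t ht
    rw [ht]
  rw [sub_eq_zero.1 hz]
  exact hm.coeFn_toLp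

/-- By du Bois-Reymond `u - Jw` is constant, and continuity at time `0` makes the constant zero. -/
theorem IsWeakTimeDeriv.eq_prim (hT : 0 < T) {u w : TimeL2 T X} (h : IsWeakTimeDeriv 1 u w)
    (h0 : VanishesAtZero u) : u = prim T X w := by
  have h1 := h.sub (isWeakTimeDeriv_prim hT w)
  rw [sub_self] at h1
  obtain ⟨c, hc⟩ := h1.ae_eq_const hT
  obtain ⟨f, hf, huf, hf0⟩ := h0
  have h2 : prim T X w =ᵐ[volume.restrict (Icc 0 T)] fun t => f t - c := by
    filter_upwards [hc, Lp.coeFn_sub u (prim T X w), huf] with t h1 h2 h3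
    rw [h2, Pi.sub_apply] at h1
    rw [← h3, ← h1, sub_sub_cancel]
  have h3 := prim_eqOn hT (hf.sub continuousOn_const) h2 (left_mem_Icc.2 hT.le)
  rw [intervalIntegral.integral_same, Pi.sub_apply, hf0, zero_sub, neg_eq_zero] at h3
  apply Lp.ext
  filter_upwards [h2, huf] with t h4 h5
  rw [h4, h5, h3, sub_zero]

theorem prim_pow_compLp (L : X →L[ℝ] Y) (k : ℕ) (u : TimeL2 T X) :
    (prim T Y ^ k) (L.compLp u) = L.compLp ((prim T X ^ k) u) := by
  induction k with
  | zero => rfl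
  | succ k ih =>
    rw [pow_succ', pow_succ', mul_apply_eq_comp, ih, prim_compLp]
    rfl

/-- A function in `H^l` whose first `l` derivatives vanish at `0` is an iterated primitive. -/
theorem timeDeriv_eq_prim_pow (hT : 0 < T) {l : ℕ} {f : TimeL2 T X} (hf : MemTimeSobolev l f)
    (h0 : ∀ k < l, VanishesAtZero (timeDeriv k f)) : f = (prim T X ^ l) (timeDeriv l f) := by
  induction l with
  | zero => exact (isWeakTimeDeriv_zero f).timeDeriv_eq.symm
  | succ l ih =>
    have h1 := ih (fun k hk => hf k (hk.trans l.le_succ)) fun k hk => h0 k (hk.trans l.lt_succ_self)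
    have h2 := (isWeakTimeDeriv_timeDeriv (hf l l.le_succ)).of_succ
      (isWeakTimeDeriv_timeDeriv (hf (l + 1) le_rfl))
    rw [h2.eq_prim hT (h0 l l.lt_succ_self)] at h1
    rwa [pow_succ]

end WeakDerivative

/-! The abstract parabolic problem in a Hilbert space -/

/-- If `‖J† ψ‖ ≤ K ‖P† ψ‖` for all `ψ`, then the range of `J` is contained in that of `P`. -/
theorem exists_preimage_of_norm_adjoint_le {E : Type*} [NormedAddCommGroup E]
    [InnerProductSpace ℝ E] [CompleteSpace E] (P J : E →L[ℝ] E) {K : ℝ} (hK : 0 ≤ K)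
    (h : ∀ ψ, ‖J.adjoint ψ‖ ≤ K * ‖P.adjoint ψ‖) (g : E) :
    ∃ u, P u = J g ∧ ‖u‖ ≤ K * ‖g‖ := by
  set R := P.adjoint.toLinearMap with hR
  -- The functional `P†ψ ↦ ⟨g, J†ψ⟩` on the range of `P†` is bounded by the hypothesis. A linear
  -- section `s` of `P†` serves to define it; its Hahn–Banach extension is represented by the
  -- desired `u`.
  obtain ⟨s, hs⟩ := R.rangeRestrict.exists_rightInverse_of_surjective R.range_rangeRestrict
  have hs' : ∀ y : LinearMap.range R, P.adjoint (s y) = y := fun y =>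
    congrArg Subtype.val (LinearMap.congr_fun hs y)
  let F : LinearMap.range R →ₗ[ℝ] ℝ := ((innerₗ E g).comp J.adjoint.toLinearMap).comp s
  have hF : ∀ y, F y = inner ℝ g (J.adjoint (s y)) := fun y => rfl
  have hb : ∀ y, ‖F y‖ ≤ K * ‖g‖ * ‖y‖ := by
    intro y
    rw [hF]
    refine (norm_inner_le_norm _ _).trans ?_
    have := h (s y)
    rw [hs' y] at this
    calc ‖g‖ * ‖J.adjoint (s y)‖ ≤ ‖g‖ * (K * ‖y‖) := by gcongr; exact this
      _ = K * ‖g‖ * ‖y‖ := by ring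
  obtain ⟨e, he, hen⟩ := exists_extension_norm_eq (LinearMap.range R) (F.mkContinuous _ hb)
  refine ⟨(InnerProductSpace.toDual ℝ E).symm e, ?_, ?_⟩
  · refine ext_inner_right ℝ fun ψ => ?_
    rw [← ContinuousLinearMap.adjoint_inner_right, InnerProductSpace.toDual_symm_apply,
      ← ContinuousLinearMap.adjoint_inner_right]
    have h1 := he ⟨P.adjoint ψ, ψ, rfl⟩
    rw [LinearMap.mkContinuous_apply, hF] at h1
    refine h1.trans ?_
    -- The section may choose a preimage other than `ψ`; the estimate shows that `J†` does not see
    -- the difference.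
    have h2 : P.adjoint (s ⟨P.adjoint ψ, ψ, rfl⟩ - ψ) = 0 := by
      rw [map_sub, hs', sub_self]
    have h3 := h (s ⟨P.adjoint ψ, ψ, rfl⟩ - ψ)
    rw [h2, norm_zero, mul_zero, norm_le_zero_iff, map_sub, sub_eq_zero] at h3
    rw [h3]
  · rw [LinearIsometryEquiv.norm_map, hen]
    exact F.mkContinuous_norm_le (by positivity) hb

section Abstract

variable {T : ℝ} {V H : Type*} [NormedAddCommGroup V] [InnerProductSpace ℝ V] [CompleteSpace V]
  [NormedAddCommGroup H] [InnerProductSpace ℝ H] [CompleteSpace H]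

/-- Operators `A 0 t` on a Hilbert space, uniformly coercive and smooth in `t ∈ (0,T)`, with
bounded derivatives `A j t`. -/
structure IsSmoothCoercive (T : ℝ) (A : ℕ → ℝ → V →L[ℝ] V) : Prop where
  memLp : ∀ j, MemLp (A j) ⊤ (volume.restrict (Icc 0 T))
  bounded : ∀ j, ∃ C, 0 ≤ C ∧ ∀ t ∈ Ioo 0 T, ‖A j t‖ ≤ C
  hasDerivAt : ∀ j, ∀ t ∈ Ioo 0 T, HasDerivAt (A j) (A (j + 1) t) t
  coercive : ∃ μ > 0, ∀ᵐ t ∂(volume.restrict (Icc 0 T)), ∀ u : V, μ * ‖u‖ ^ 2 ≤ inner ℝ (A 0 t u) u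

/-- The operator `v ↦ ∂_t^l (A_k J^l v) = ∑_j (l choose j) A_{k+j} J^j v`. -/
def leibnizOp (T : ℝ) (A : ℕ → ℝ → V →L[ℝ] V) : ℕ → ℕ → TimeL2 T V →L[ℝ] TimeL2 T V
  | 0, k => lpMul (A k)
  | l + 1, k => (leibnizOp T A l (k + 1)).comp (prim T V) + leibnizOp T A l k

variable {A : ℕ → ℝ → V →L[ℝ] V}

theorem IsSmoothCoercive.lpMul_prim (hA : IsSmoothCoercive T A) (k : ℕ) (u : TimeL2 T V) :
    lpMul (A k) (prim T V u) = prim T V (lpMul (A (k + 1)) (prim T V u) + lpMul (A k) u) := by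
  obtain ⟨C, -, hC⟩ := hA.bounded k
  exact ParabolicSobolev.lpMul_prim (hA.memLp k) (hA.memLp (k + 1)) hC (hA.hasDerivAt k) u

/-- Integrated form of `∂_t^(l+1) = ∂_t ∂_t^l`. The index `k` varies in the induction, since each
step of the Leibniz rule moves one derivative onto the coefficient. -/
theorem IsSmoothCoercive.prim_leibnizOp (hA : IsSmoothCoercive T A) (l k : ℕ) (u : TimeL2 T V) :
    prim T V (leibnizOp T A (l + 1) k u) = leibnizOp T A l k (prim T V u) := by
  induction l generalizing k u with
  | zero => exact (hA.lpMul_prim k u).symm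
  | succ l ih =>
    change prim T V (leibnizOp T A (l + 1) (k + 1) (prim T V u) + leibnizOp T A (l + 1) k u) = _
    rw [map_add, ih, ih]
    rfl

theorem IsSmoothCoercive.prim_pow_leibnizOp (hA : IsSmoothCoercive T A) (l : ℕ) (u : TimeL2 T V) :
    (prim T V ^ l) (leibnizOp T A l 0 u) = lpMul (A 0) ((prim T V ^ l) u) := by
  induction l generalizing u with
  | zero => rfl
  | succ l ih =>
    rw [pow_succ, mul_apply_eq_comp, hA.prim_leibnizOp, ih]
    rfl

/-- Scalar weights commute with the operators, so the constant does not depend on `c`. -/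
theorem IsSmoothCoercive.norm_expWeight_lpMul_le (hA : IsSmoothCoercive T A) (k : ℕ) :
    ∃ C, 0 ≤ C ∧ ∀ (c : ℝ) (u : TimeL2 T V),
      ‖expWeight T c V (lpMul (A k) u)‖ ≤ C * ‖expWeight T c V u‖ := by
  obtain ⟨C, hC0, hC⟩ := hA.bounded k
  refine ⟨C, hC0, fun c u => ?_⟩
  rw [expWeight_lpMul c (hA.memLp k)]
  refine norm_lpMul_apply_le _ hC0 ?_ _
  filter_upwards [ae_Ioo T] with t ht using hC t ht

theorem norm_expWeight_prim_le (hT : 0 ≤ T) {c : ℝ} (hc : 0 < c) (u : TimeL2 T V) :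
    ‖expWeight T (-c) V (prim T V u)‖ ≤ ‖expWeight T (-c) V u‖ / c := by
  rw [le_div_iff₀' hc]
  exact mul_norm_expWeight_prim_le hT c u

/-- The memory terms of `leibnizOp` are small in weighted norms. -/
theorem IsSmoothCoercive.norm_leibnizOp_sub_le (hA : IsSmoothCoercive T A) (hT : 0 ≤ T) (l k : ℕ) :
    ∃ K, 0 ≤ K ∧ ∀ c : ℝ, 1 ≤ c → ∀ u : TimeL2 T V,
      ‖expWeight T (-c) V (leibnizOp T A l k u - lpMul (A k) u)‖ ≤
        K / c * ‖expWeight T (-c) V u‖ := by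
  induction l generalizing k with
  | zero => exact ⟨0, le_rfl, fun c _ u => by simp [leibnizOp]⟩
  | succ l ih =>
    obtain ⟨K, hK, h⟩ := ih k
    obtain ⟨K', hK', h'⟩ := ih (k + 1)
    obtain ⟨C, hC, h''⟩ := hA.norm_expWeight_lpMul_le (k + 1)
    refine ⟨K' + C + K, by positivity, fun c hc u => ?_⟩
    have hc0 : 0 < c := one_pos.trans_le hc
    have e : leibnizOp T A (l + 1) k u - lpMul (A k) u =
        (leibnizOp T A l (k + 1) (prim T V u) - lpMul (A (k + 1)) (prim T V u)) +
          lpMul (A (k + 1)) (prim T V u) + (leibnizOp T A l k u - lpMul (A k) u) := by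
      change leibnizOp T A l (k + 1) (prim T V u) + leibnizOp T A l k u - _ = _
      abel
    rw [e, map_add, map_add]
    refine (norm_add₃_le).trans ?_
    have h1 := h' c hc (prim T V u)
    have h2 := h'' (-c) (prim T V u)
    have h3 := h c hc u
    have h4 := norm_expWeight_prim_le hT hc0 u
    -- The term carrying `K'` already gains `1/c` from the additional primitive, so its own factor
    -- `1/c` can be given up.
    have h5 : K' / c ≤ K' := div_le_self hK' hc
    calc _ ≤ K' * (‖expWeight T (-c) V u‖ / c) + C * (‖expWeight T (-c) V u‖ / c) +
          K / c * ‖expWeight T (-c) V u‖ := by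
          refine add_le_add_three (h1.trans ?_) (h2.trans ?_) h3 <;> gcongr
      _ = _ := by ring

theorem IsSmoothCoercive.coercive_lpMul (hA : IsSmoothCoercive T A) :
    ∃ μ > 0, ∀ (c : ℝ) (u : TimeL2 T V), μ * ‖expWeight T c V u‖ ^ 2 ≤
      inner ℝ (expWeight T c V (lpMul (A 0) u)) (expWeight T c V u) := by
  obtain ⟨μ, hμ, h⟩ := hA.coercive
  refine ⟨μ, hμ, fun c u => ?_⟩
  rw [expWeight_lpMul c (hA.memLp 0), ← real_inner_self_eq_norm_sq, L2.inner_def, L2.inner_def,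
    ← integral_const_mul]
  refine integral_mono_ae ((L2.integrable_inner _ _).const_mul _) (L2.integrable_inner _ _) ?_
  filter_upwards [h, coeFn_lpMul (hA.memLp 0) (expWeight T c V u)] with t h1 h2
  rw [h2, real_inner_self_eq_norm_sq]
  exact h1 _

theorem IsSmoothCoercive.coercive_leibnizOp (hA : IsSmoothCoercive T A) (hT : 0 ≤ T) (l : ℕ) :
    ∃ μ > 0, ∃ c : ℝ, 0 ≤ c ∧ ∀ u : TimeL2 T V, μ * ‖expWeight T (-c) V u‖ ^ 2 ≤
      inner ℝ (expWeight T (-c) V (leibnizOp T A l 0 u)) (expWeight T (-c) V u) := by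
  obtain ⟨μ, hμ, h⟩ := hA.coercive_lpMul
  obtain ⟨K, hK, hL⟩ := hA.norm_leibnizOp_sub_le hT l 0
  -- This gives `K / c ≤ μ / 2`, so half of the coercivity survives the memory terms, whose estimate
  -- requires `c ≥ 1`.
  set c := max 1 (2 * K / μ) with hc
  have hc1 : 1 ≤ c := le_max_left _ _
  have hc0 : 0 < c := one_pos.trans_le hc1
  have hKc : K / c ≤ μ / 2 := by
    have : 2 * K / μ ≤ c := le_max_right _ _
    rw [div_le_iff₀ hμ] at this
    rw [div_le_iff₀ hc0]
    linarith
  refine ⟨μ / 2, by positivity, c, hc0.le, fun u => ?_⟩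
  set M := expWeight T (-c) V
  have h1 := h (-c) u
  have h2 : |inner ℝ (M (leibnizOp T A l 0 u - lpMul (A 0) u)) (M u)| ≤ μ / 2 * ‖M u‖ ^ 2 := by
    refine (abs_real_inner_le_norm _ _).trans ?_
    calc _ ≤ (K / c * ‖M u‖) * ‖M u‖ := by gcongr; exact hL c hc1 u
      _ ≤ (μ / 2 * ‖M u‖) * ‖M u‖ := by gcongr
      _ = _ := by ring
  have h3 := (abs_le.1 h2).1
  rw [map_sub, inner_sub_left] at h3
  linarith

variable {i : V →L[ℝ] H} {G : V →L[ℝ] V}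

theorem inner_compLp (hG : ∀ u v, inner ℝ (G u) v = inner ℝ (i u) (i v)) (u v : TimeL2 T V) :
    inner ℝ (G.compLp u) v = inner ℝ (i.compLp u) (i.compLp v) := by
  rw [L2.inner_def, L2.inner_def]
  refine integral_congr_ae ?_
  filter_upwards [G.coeFn_compLp u, i.coeFn_compLp u, i.coeFn_compLp v] with t h1 h2 h3
  rw [h1, h2, h3, hG]

/-- Since `G = i†i` and `i` commutes with weights and primitives, this is the energy inequality for
`i u` in `H`. -/
theorem inner_compLp_prim_nonneg (hT : 0 ≤ T) (hG : ∀ u v, inner ℝ (G u) v = inner ℝ (i u) (i v))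
    {c : ℝ} (hc : 0 ≤ c) (u : TimeL2 T V) :
    0 ≤ inner ℝ (expWeight T (-c) V (G.compLp u)) (expWeight T (-c) V (prim T V u)) := by
  rw [expWeight_compLp, inner_compLp hG, ← expWeight_compLp, ← expWeight_compLp, ← prim_compLp]
  exact inner_prim_nonneg hT hc _

/-- Solvability of `G v' + L v = g`, `v(0) = 0`, where `L` is coercive in a weighted norm. -/
theorem exists_solution (hT : 0 ≤ T) (hG : ∀ u v, inner ℝ (G u) v = inner ℝ (i u) (i v))
    (L : TimeL2 T V →L[ℝ] TimeL2 T V) {μ c : ℝ} (hμ : 0 < μ) (hc : 0 ≤ c)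
    (hL : ∀ u : TimeL2 T V, μ * ‖expWeight T (-c) V u‖ ^ 2 ≤
      inner ℝ (expWeight T (-c) V (L u)) (expWeight T (-c) V u)) (g : TimeL2 T V) :
    ∃ v : TimeL2 T V, G.compLp v = prim T V (g - L v) ∧
      ‖v‖ ≤ Real.exp (c * T) ^ 2 / μ * ‖g‖ := by
  set J := prim T V
  -- With this operator the equation becomes `P v = J g`.
  set P : TimeL2 T V →L[ℝ] TimeL2 T V :=
    G.compLpL 2 (volume.restrict (Icc 0 T)) + J.comp L with hP
  have hPu : ∀ u, P u = G.compLp u + J (L u) := fun u => rfl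
  have key : ∀ ψ, ‖J.adjoint ψ‖ ≤ Real.exp (c * T) ^ 2 / μ * ‖P.adjoint ψ‖ := by
    intro ψ
    set q := J.adjoint ψ with hq
    -- Pairing `P†ψ` with `e^{2ct} J†ψ` turns the `L`-part into `⟨M L φ, M φ⟩`, to which weighted
    -- coercivity applies.
    set φ := expWeight T (2 * c) V q with hφ
    set M := expWeight T (-c) V with hM
    have hqM : q = M (M φ) := by
      rw [hM, hφ, expWeight_add, expWeight_add, show -c + -c + 2 * c = 0 by ring,
        expWeight_zero]
    have h1 : inner ℝ (P.adjoint ψ) φ = inner ℝ ψ (G.compLp φ) + inner ℝ (M (L φ)) (M φ) := by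
      rw [ContinuousLinearMap.adjoint_inner_left, hPu, inner_add_right,
        ← ContinuousLinearMap.adjoint_inner_left J, ← hq, hqM, hM, inner_expWeight,
        real_inner_comm (expWeight T (-c) V (L φ))]
    have h2 : 0 ≤ inner ℝ ψ (G.compLp φ) := by
      -- Symmetry of `G` and its commutation with `J` and the weights carry the `G`-part over to `⟨M
      -- G χ, M J χ⟩`, which is nonnegative.
      set χ := expWeight T (2 * c) V ψ with hχ
      have hψ : ψ = M (M χ) := by
        rw [hM, hχ, expWeight_add, expWeight_add, show -c + -c + 2 * c = 0 by ring,
          expWeight_zero]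
      have h3 : inner ℝ ψ (G.compLp φ) = inner ℝ (M (G.compLp χ)) (M (J χ)) := by
        have hsymm : inner ℝ ψ (G.compLp φ) = inner ℝ (G.compLp ψ) φ := by
          rw [real_inner_comm, inner_compLp hG, inner_compLp hG, real_inner_comm]
        rw [hsymm, hφ, ← inner_expWeight, hq, ContinuousLinearMap.adjoint_inner_right,
          expWeight_compLp, ← hχ, prim_compLp, inner_compLp hG, real_inner_comm,
          ← inner_compLp hG]
        conv_lhs => rw [hψ]
        rw [hM, ← expWeight_compLp, inner_expWeight, expWeight_compLp]
      rw [h3]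
      exact inner_compLp_prim_nonneg hT hG hc χ
    have h3 : μ * ‖M φ‖ ^ 2 ≤ ‖P.adjoint ψ‖ * ‖φ‖ :=
      (by linarith [hL φ] : μ * ‖M φ‖ ^ 2 ≤ inner ℝ (P.adjoint ψ) φ).trans
        (real_inner_le_norm _ _)
    have h4 : ‖φ‖ ≤ Real.exp (c * T) * ‖M φ‖ := by
      have := norm_le_expWeight (-c) φ
      rwa [abs_neg, abs_of_nonneg hc] at this
    have h5 : ‖q‖ ≤ Real.exp (c * T) * ‖M φ‖ := by
      have := norm_expWeight_le (-c) (M φ)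
      rwa [abs_neg, abs_of_nonneg hc, ← hM, ← hqM] at this
    have h6 : μ * ‖M φ‖ ≤ Real.exp (c * T) * ‖P.adjoint ψ‖ := by
      rcases (norm_nonneg (M φ)).eq_or_lt with h0 | h0
      · rw [← h0, mul_zero]
        positivity
      · refine le_of_mul_le_mul_right ?_ h0
        calc μ * ‖M φ‖ * ‖M φ‖ = μ * ‖M φ‖ ^ 2 := by ring
          _ ≤ ‖P.adjoint ψ‖ * ‖φ‖ := h3
          _ ≤ ‖P.adjoint ψ‖ * (Real.exp (c * T) * ‖M φ‖) := by gcongr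
          _ = _ := by ring
    rw [div_mul_eq_mul_div, le_div_iff₀ hμ]
    calc ‖q‖ * μ ≤ Real.exp (c * T) * ‖M φ‖ * μ := by gcongr
      _ = Real.exp (c * T) * (μ * ‖M φ‖) := by ring
      _ ≤ Real.exp (c * T) * (Real.exp (c * T) * ‖P.adjoint ψ‖) := by gcongr
      _ = _ := by ring
  obtain ⟨v, hv, hvn⟩ := exists_preimage_of_norm_adjoint_le P J (by positivity) key g
  refine ⟨v, ?_, hvn⟩
  rw [map_sub, ← hv, hPu, add_sub_cancel_right]

/-- The equation is paired with `Z = Jz` instead of `z`, so that only primitives of `V`-valued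
functions occur and no energy identity for `H^{-m}`-valued derivatives is needed. The Leibniz rule
replaces `J(A z)` by `A Z - J(A' Z)`; a large weight absorbs the last term. -/
theorem IsSmoothCoercive.eq_zero_of_homogeneous (hA : IsSmoothCoercive T A) (hT : 0 < T)
    (hG : ∀ u v, inner ℝ (G u) v = inner ℝ (i u) (i v)) {z : TimeL2 T V}
    (hz : G.compLp z + prim T V (lpMul (A 0) z) = 0) : z = 0 := by
  obtain ⟨μ, hμ, hcoer⟩ := hA.coercive_lpMul
  obtain ⟨C, hC, hA1⟩ := hA.norm_expWeight_lpMul_le 1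
  set c := max 1 (2 * C / μ)
  have hc0 : 0 < c := one_pos.trans_le (le_max_left _ _)
  have hCc : C / c ≤ μ / 2 := by
    have : 2 * C / μ ≤ c := le_max_right _ _
    rw [div_le_iff₀ hμ] at this
    rw [div_le_iff₀ hc0]
    linarith
  set Z := prim T V z with hZ
  set M := expWeight T (-c) V
  have h1 : G.compLp z + lpMul (A 0) Z - prim T V (lpMul (A 1) Z) = 0 := by
    rw [hA.lpMul_prim 0 z, map_add, ← hz]
    abel
  have h2 := congrArg (fun y => inner ℝ (M y) (M Z)) h1
  simp only [map_add, map_sub, inner_add_left, inner_sub_left, map_zero, inner_zero_left] at h2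
  have h3 := inner_compLp_prim_nonneg hT.le hG hc0.le z
  have h4 := hcoer (-c) Z
  have h5 : inner ℝ (M (prim T V (lpMul (A 1) Z))) (M Z) ≤ μ / 2 * ‖M Z‖ ^ 2 := by
    refine (real_inner_le_norm _ _).trans ?_
    calc _ ≤ (C * ‖M Z‖ / c) * ‖M Z‖ := by
          gcongr
          refine (norm_expWeight_prim_le hT.le hc0 _).trans ?_
          gcongr
          exact hA1 _ _
      _ = C / c * ‖M Z‖ ^ 2 := by ring
      _ ≤ _ := by gcongr
  have h6 : ‖M Z‖ ^ 2 = 0 := by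
    refine le_antisymm ?_ (by positivity)
    by_contra hn
    nlinarith
  have h7 : Z = 0 := by
    have := norm_le_expWeight (-c) Z
    rwa [pow_eq_zero_iff two_ne_zero |>.1 h6, mul_zero, norm_le_zero_iff] at this
  exact prim_injective hT h7

end Abstract

/-! Multiplication by smooth time-dependent coefficients -/

section Coefficient

variable {E : Type*} [NormedAddCommGroup E] [NormedSpace ℝ E] [MeasurableSpace E] [BorelSpace E]
  [SecondCountableTopology E] {ν : Measure E} {D : Set E} {T : ℝ} {b : ℝ × E → ℝ}

/-- The time derivative `∂_t^k b` on `(0,T]`. -/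
def coeffDeriv (T : ℝ) (b : ℝ × E → ℝ) (k : ℕ) (t : ℝ) (x : E) : ℝ :=
  iteratedDerivWithin k (fun s => b (s, x)) (Ioc 0 T) t

theorem coeffDeriv_zero (T : ℝ) (b : ℝ × E → ℝ) (t : ℝ) (x : E) :
    coeffDeriv T b 0 t x = b (t, x) := by
  simp [coeffDeriv]

theorem hasDerivWithinAt_coeffDeriv (hb : ContDiffOn ℝ ∞ b (Ioc 0 T ×ˢ D)) {x : E} (hx : x ∈ D)
    (k : ℕ) {t : ℝ} (ht : t ∈ Ioc 0 T) :
    HasDerivWithinAt (fun s => coeffDeriv T b k s x) (coeffDeriv T b (k + 1) t x) (Ioc 0 T) t := by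
  have h1 : ContDiffOn ℝ ∞ (fun s => b (s, x)) (Ioc 0 T) :=
    hb.comp (contDiff_id.prodMk contDiff_const).contDiffOn fun s hs => ⟨hs, hx⟩
  have h2 := (h1.differentiableOn_iteratedDerivWithin (m := k) (by exact_mod_cast ENat.natCast_lt_top k)
    (uniqueDiffOn_Ioc 0 T)) t ht
  have h3 := h2.hasDerivWithinAt
  rwa [← iteratedDerivWithin_succ] at h3

/-- Each further time derivative is a pointwise limit in `x` of difference quotients along a
sequence of times. -/
theorem aestronglyMeasurable_coeffDeriv (hD : IsOpen D) (hb : ContDiffOn ℝ ∞ b (Ioc 0 T ×ˢ D))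
    (k : ℕ) {t : ℝ} (ht : t ∈ Ioc 0 T) :
    AEStronglyMeasurable (coeffDeriv T b k t) (ν.restrict D) := by
  induction k generalizing t with
  | zero =>
    have : ContinuousOn (coeffDeriv T b 0 t) D := by
      rw [funext (coeffDeriv_zero T b t)]
      exact hb.continuousOn.comp (by fun_prop) fun x hx => ⟨ht, hx⟩
    exact this.aestronglyMeasurable hD.measurableSet
  | succ k ih =>
    have hs0 : Filter.Tendsto (fun n : ℕ => 1 / ((n : ℝ) + 1)) Filter.atTop (nhds 0) :=
      tendsto_one_div_add_atTop_nhds_zero_nat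
    have hle : ∀ n : ℕ, 0 < 1 / (2 * ((n : ℝ) + 1)) ∧ 1 / (2 * ((n : ℝ) + 1)) < 1 := by
      intro n
      refine ⟨by positivity, (div_lt_one (by positivity)).2 ?_⟩
      have : (0 : ℝ) ≤ n := n.cast_nonneg
      linarith
    -- The times approach `t` from the left and are positive, hence stay in `(0,T]` even for `t =
    -- T`.
    set s : ℕ → ℝ := fun n => t * (1 - 1 / (2 * ((n : ℝ) + 1))) with hs
    have hsm : ∀ n, s n ∈ Ioc 0 T := fun n => by
      obtain ⟨h1, h2⟩ := hle n
      exact ⟨mul_pos ht.1 (by linarith), (mul_le_of_le_one_right ht.1.le (by linarith)).trans ht.2⟩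
    have hsne : ∀ n, s n ≠ t := fun n => by
      obtain ⟨h1, h2⟩ := hle n
      exact (mul_lt_of_lt_one_right ht.1 (by linarith)).ne
    have hst : Filter.Tendsto s Filter.atTop (nhds t) := by
      have : Filter.Tendsto (fun n : ℕ => t * (1 - 1 / 2 * (1 / ((n : ℝ) + 1)))) Filter.atTop
          (nhds (t * (1 - 1 / 2 * 0))) := (tendsto_const_nhds.sub (hs0.const_mul _)).const_mul _
      simpa [hs, mul_comm] using this
    have hst' : Filter.Tendsto s Filter.atTop (nhdsWithin t (Ioc 0 T \ {t})) :=
      tendsto_nhdsWithin_iff.2 ⟨hst, .of_forall fun n => ⟨hsm n, hsne n⟩⟩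
    refine aestronglyMeasurable_of_tendsto_ae Filter.atTop
      (f := fun n x => slope (fun r => coeffDeriv T b k r x) t (s n)) (fun n => ?_) ?_
    · simp only [slope_def_field]
      exact ((ih (hsm n)).sub (ih ht)).mul_const _
    · filter_upwards [ae_restrict_mem hD.measurableSet] with x hx
      exact (hasDerivWithinAt_iff_tendsto_slope.1 (hasDerivWithinAt_coeffDeriv hb hx k ht)).comp hst'

/-- Multiplication by a bounded real function on `L_2`. -/
def mulL2 (ν : Measure E) (b : E → ℝ) : Lp ℝ 2 ν →L[ℝ] Lp ℝ 2 ν :=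
  lpMul fun x => b x • ContinuousLinearMap.id ℝ ℝ

theorem coeFn_mulL2 {b : E → ℝ} (hb : MemLp b ⊤ ν) (u : Lp ℝ 2 ν) :
    mulL2 ν b u =ᵐ[ν] fun x => b x * u x :=
  coeFn_lpMul (memLp_smul_id hb) u

theorem memLp_coeffDeriv (hD : IsOpen D) (hb : ContDiffOn ℝ ∞ b (Ioc 0 T ×ˢ D)) {k : ℕ} {M : ℝ}
    (hM : ∀ t ∈ Ioc 0 T, ∀ x ∈ D, |coeffDeriv T b k t x| ≤ M) {t : ℝ} (ht : t ∈ Ioc 0 T) :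
    MemLp (coeffDeriv T b k t) ⊤ (ν.restrict D) := by
  refine memLp_top_of_bound (aestronglyMeasurable_coeffDeriv hD hb k ht) M ?_
  filter_upwards [ae_restrict_mem hD.measurableSet] with x hx using hM t ht x hx

theorem norm_mulL2_coeffDeriv_le (hD : IsOpen D) (hb : ContDiffOn ℝ ∞ b (Ioc 0 T ×ˢ D)) {k : ℕ}
    {M : ℝ} (hM0 : 0 ≤ M) (hM : ∀ t ∈ Ioc 0 T, ∀ x ∈ D, |coeffDeriv T b k t x| ≤ M)
    {t : ℝ} (ht : t ∈ Ioc 0 T) : ‖mulL2 (ν.restrict D) (coeffDeriv T b k t)‖ ≤ M := by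
  refine ContinuousLinearMap.opNorm_le_bound _ hM0 fun u => Lp.norm_le_mul_norm_of_ae_le_mul ?_
  filter_upwards [ae_restrict_mem hD.measurableSet, coeFn_mulL2 (memLp_coeffDeriv hD hb hM ht) u]
    with x hx h1
  rw [h1, norm_mul]
  exact mul_le_mul_of_nonneg_right (hM t ht x hx) (norm_nonneg _)

/-- The mean value inequality, used twice, gives a Taylor remainder uniform in `x`. -/
theorem abs_coeffDeriv_sub_sub_le (hb : ContDiffOn ℝ ∞ b (Ioc 0 T ×ˢ D)) {k : ℕ} {M : ℝ}
    (hM0 : 0 ≤ M) (hM : ∀ t ∈ Ioc 0 T, ∀ x ∈ D, |coeffDeriv T b (k + 2) t x| ≤ M) {s t : ℝ}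
    (hs : s ∈ Ioc 0 T) (ht : t ∈ Ioc 0 T) {x : E} (hx : x ∈ D) :
    |coeffDeriv T b k s x - coeffDeriv T b k t x - (s - t) * coeffDeriv T b (k + 1) t x| ≤
      M * |s - t| ^ 2 := by
  have hsub : uIcc t s ⊆ Ioc 0 T := ordConnected_Ioc.uIcc_subset ht hs
  have h1 : ∀ r ∈ uIcc t s, |coeffDeriv T b (k + 1) r x - coeffDeriv T b (k + 1) t x| ≤
      M * |s - t| := by
    intro r hr
    refine ((convex_uIcc t s).norm_image_sub_le_of_norm_hasDerivWithin_le
      (fun r hr => (hasDerivWithinAt_coeffDeriv hb hx (k + 1) (hsub hr)).mono hsub)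
      (fun r hr => hM r (hsub hr) x hx) left_mem_uIcc hr).trans ?_
    exact mul_le_mul_of_nonneg_left (abs_sub_left_of_mem_uIcc hr) hM0
  have h2 := (convex_uIcc t s).norm_image_sub_le_of_norm_hasDerivWithin_le
    (f := fun r => coeffDeriv T b k r x - r * coeffDeriv T b (k + 1) t x)
    (f' := fun r => coeffDeriv T b (k + 1) r x - 1 * coeffDeriv T b (k + 1) t x)
    (fun r hr => ((hasDerivWithinAt_coeffDeriv hb hx k (hsub hr)).mono hsub).sub
      ((hasDerivWithinAt_id r _).mul_const _)) (C := M * |s - t|)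
    (fun r hr => by rw [one_mul]; exact h1 r hr) left_mem_uIcc right_mem_uIcc
  rw [pow_two, ← mul_assoc]
  refine le_trans (le_of_eq ?_) h2
  rw [Real.norm_eq_abs]
  congr 1
  ring

/-- A multiplication operator is bounded by the supremum of its multiplier, so the uniform Taylor
remainder yields differentiability in operator norm. -/
theorem hasDerivAt_mulL2_coeffDeriv (hD : IsOpen D) (hb : ContDiffOn ℝ ∞ b (Ioc 0 T ×ˢ D))
    (hM : ∀ k : ℕ, ∃ M : ℝ, 0 ≤ M ∧ ∀ t ∈ Ioc 0 T, ∀ x ∈ D, |coeffDeriv T b k t x| ≤ M) (k : ℕ)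
    {t : ℝ} (ht : t ∈ Ioo 0 T) :
    HasDerivAt (fun t => mulL2 (ν.restrict D) (coeffDeriv T b k t))
      (mulL2 (ν.restrict D) (coeffDeriv T b (k + 1) t)) t := by
  obtain ⟨M0, -, hM0⟩ := hM k
  obtain ⟨M1, -, hM1⟩ := hM (k + 1)
  obtain ⟨M, hMn, hM2⟩ := hM (k + 2)
  have ht' := Ioo_subset_Ioc_self ht
  rw [hasDerivAt_iff_isLittleO]
  refine Asymptotics.IsBigO.trans_isLittleO (g := fun s => (s - t) ^ 2) ?_
    (by simpa using Asymptotics.isLittleO_pow_sub_sub t one_lt_two)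
  refine Asymptotics.IsBigO.of_bound M ?_
  filter_upwards [isOpen_Ioo.mem_nhds ht] with s hs
  have hs' := Ioo_subset_Ioc_self hs
  refine ContinuousLinearMap.opNorm_le_bound _ (by positivity) fun u =>
    Lp.norm_le_mul_norm_of_ae_le_mul ?_
  set B0 := mulL2 (ν.restrict D) (coeffDeriv T b k s) u
  set B1 := mulL2 (ν.restrict D) (coeffDeriv T b k t) u
  set B2 := mulL2 (ν.restrict D) (coeffDeriv T b (k + 1) t) u
  filter_upwards [ae_restrict_mem hD.measurableSet, Lp.coeFn_sub (B0 - B1) ((s - t) • B2),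
    Lp.coeFn_sub B0 B1, Lp.coeFn_smul (s - t) B2,
    coeFn_mulL2 (memLp_coeffDeriv hD hb hM0 hs') u, coeFn_mulL2 (memLp_coeffDeriv hD hb hM0 ht') u,
    coeFn_mulL2 (memLp_coeffDeriv hD hb hM1 ht') u] with x hx h1 h2 h3 h4 h5 h6
  change ‖(B0 - B1 - (s - t) • B2 : Lp ℝ 2 (ν.restrict D)) x‖ ≤ _
  rw [h1, Pi.sub_apply, h2, h3, Pi.sub_apply, Pi.smul_apply, h4, h5, h6, smul_eq_mul, ← mul_assoc,
    ← sub_mul, ← sub_mul, norm_mul, norm_pow]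
  exact mul_le_mul_of_nonneg_right (abs_coeffDeriv_sub_sub_le hb hMn hM2 hs' ht' hx) (norm_nonneg _)

end Coefficient

/-! ### The operators on `H̊^m(D)` attached to the bilinear form -/

section Operator

variable {d m : ℕ} {D : Set (EuclideanSpace ℝ (Fin d))} {T : ℝ} {a : Coefficients d m}

/-- The operators on `H̊^m(D)` representing the form `B(t,·,·)` and its time derivatives. -/
def formOp (D : Set (EuclideanSpace ℝ (Fin d))) (T : ℝ) (a : Coefficients d m) (k : ℕ) (t : ℝ) :
    SobolevZero D m →L[ℝ] SobolevZero D m :=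
  ∑ α : MultiIndex d m, ∑ β : MultiIndex d m,
    ((SobolevZero.weakDeriv (D := D) α).adjoint).comp
      ((mulL2 (volume.restrict D) (coeffDeriv T (a α β) k t)).comp (SobolevZero.weakDeriv β))

theorem IsParabolic.bounded_coeffDeriv (ha : IsParabolic D T a) (α β : MultiIndex d m) (k : ℕ) :
    ∃ M : ℝ, 0 ≤ M ∧ ∀ t ∈ Ioc 0 T, ∀ x ∈ D, |coeffDeriv T (a α β) k t x| ≤ M := by
  obtain ⟨M, hM⟩ := ha.bounded α β k
  exact ⟨|M|, abs_nonneg M, fun t ht x hx => (hM t ht x hx).trans (le_abs_self M)⟩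

theorem IsParabolic.inner_formOp (ha : IsParabolic D T a) (hD : IsOpen D) {t : ℝ}
    (ht : t ∈ Ioc 0 T) (u v : SobolevZero D m) :
    inner ℝ (formOp D T a 0 t u) v = bilinForm a t u v := by
  simp only [formOp, bilinForm, sum_apply, sum_inner,
    ContinuousLinearMap.comp_apply, ContinuousLinearMap.adjoint_inner_left]
  refine Finset.sum_congr rfl fun α _ => Finset.sum_congr rfl fun β _ => ?_
  obtain ⟨M, -, hM⟩ := ha.bounded_coeffDeriv α β 0
  rw [L2.inner_def]
  refine integral_congr_ae ?_
  filter_upwards [coeFn_mulL2 (memLp_coeffDeriv hD (ha.smooth α β) hM ht)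
    (SobolevZero.weakDeriv β u)] with x hx
  rw [hx, coeffDeriv_zero]
  simp [mul_comm]

theorem IsParabolic.hasDerivAt_formOp (ha : IsParabolic D T a) (hD : IsOpen D) (k : ℕ) {t : ℝ}
    (ht : t ∈ Ioo 0 T) : HasDerivAt (formOp D T a k) (formOp D T a (k + 1) t) t := by
  refine HasDerivAt.fun_sum fun α _ => HasDerivAt.fun_sum fun β _ => ?_
  have h := hasDerivAt_mulL2_coeffDeriv (ν := volume) hD (ha.smooth α β)
    (ha.bounded_coeffDeriv α β) k ht
  let L : (L2 D →L[ℝ] L2 D) →L[ℝ] (SobolevZero D m →L[ℝ] SobolevZero D m) :=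
    (ContinuousLinearMap.compL ℝ (SobolevZero D m) (L2 D) (SobolevZero D m)
      (SobolevZero.weakDeriv α).adjoint).comp
    ((ContinuousLinearMap.compL ℝ (SobolevZero D m) (L2 D) (L2 D)).flip (SobolevZero.weakDeriv β))
  exact L.hasFDerivAt.comp_hasDerivAt t h

theorem IsParabolic.norm_formOp_le (ha : IsParabolic D T a) (hD : IsOpen D) (k : ℕ) :
    ∃ C, 0 ≤ C ∧ ∀ t ∈ Ioo 0 T, ‖formOp D T a k t‖ ≤ C := by
  choose M hM0 hM using fun α β => ha.bounded_coeffDeriv α β k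
  refine ⟨∑ α, ∑ β, ‖(SobolevZero.weakDeriv (D := D) α).adjoint‖ *
    (M α β * ‖(SobolevZero.weakDeriv β : SobolevZero D m →L[ℝ] L2 D)‖),
    Finset.sum_nonneg fun α _ => Finset.sum_nonneg fun β _ => by have := hM0 α β; positivity,
    fun t ht => ?_⟩
  refine norm_sum_le_of_le _ fun α _ => norm_sum_le_of_le _ fun β _ => ?_
  refine (ContinuousLinearMap.opNorm_comp_le _ _).trans ?_
  gcongr
  refine (ContinuousLinearMap.opNorm_comp_le _ _).trans ?_
  gcongr
  exact norm_mulL2_coeffDeriv_le hD (ha.smooth α β) (hM0 α β) (hM α β) (Ioo_subset_Ioc_self ht)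

theorem IsParabolic.isSmoothCoercive (ha : IsParabolic D T a) (hD : IsOpen D) :
    IsSmoothCoercive T (formOp D T a) where
  memLp k := by
    obtain ⟨C, -, hC⟩ := ha.norm_formOp_le hD k
    refine memLp_top_of_bound ?_ C ?_
    -- Measurability in time comes from norm continuity on the open interval; the endpoints are
    -- null.
    · rw [← restrict_Ioo_eq_restrict_Icc]
      exact ContinuousOn.aestronglyMeasurable (fun t ht =>
        (ha.hasDerivAt_formOp hD k ht).continuousAt.continuousWithinAt) measurableSet_Ioo
    · filter_upwards [ae_Ioo T] with t ht using hC t ht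
  bounded := ha.norm_formOp_le hD
  hasDerivAt k t ht := ha.hasDerivAt_formOp hD k ht
  coercive := by
    obtain ⟨μ, hμ, h⟩ := ha.coercive
    refine ⟨μ, hμ, ?_⟩
    filter_upwards [h, ae_Ioo T] with t h1 h2 u
    rw [ha.inner_formOp hD (Ioo_subset_Ioc_self h2)]
    exact h1 u

end Operator

/-! The Riesz isomorphism -/

section Riesz

variable (V : Type*) [NormedAddCommGroup V] [InnerProductSpace ℝ V] [CompleteSpace V]

/-- The Riesz isomorphism `V → V'`. -/
def toDualL : V →L[ℝ] StrongDual ℝ V :=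
  LinearMap.mkContinuous
    { toFun := InnerProductSpace.toDual ℝ V
      map_add' := map_add _
      map_smul' := fun c u => by simp } 1 fun u => by simp

/-- The inverse `V' → V` of the Riesz isomorphism. -/
def ofDualL : StrongDual ℝ V →L[ℝ] V :=
  LinearMap.mkContinuous
    { toFun := (InnerProductSpace.toDual ℝ V).symm
      map_add' := map_add _
      map_smul' := fun c u => by simp } 1 fun u => by simp

variable {V}

theorem inner_ofDualL (f : StrongDual ℝ V) (v : V) : inner ℝ (ofDualL V f) v = f v :=
  InnerProductSpace.toDual_symm_apply

theorem toDualL_ofDualL (f : StrongDual ℝ V) : toDualL V (ofDualL V f) = f :=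
  (InnerProductSpace.toDual ℝ V).apply_symm_apply f

theorem ofDualL_toDualL (u : V) : ofDualL V (toDualL V u) = u :=
  (InnerProductSpace.toDual ℝ V).symm_apply_apply u

theorem norm_ofDualL (f : StrongDual ℝ V) : ‖ofDualL V f‖ = ‖f‖ :=
  (InnerProductSpace.toDual ℝ V).symm.norm_map f

theorem norm_toDualL (u : V) : ‖toDualL V u‖ = ‖u‖ :=
  (InnerProductSpace.toDual ℝ V).norm_map u

end Riesz

/-! ### Pointwise application of a fixed operator -/

section CompLp

variable {Ω : Type*} [MeasurableSpace Ω] {μ : Measure Ω}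
variable {X Y Z : Type*} [NormedAddCommGroup X] [NormedSpace ℝ X]
  [NormedAddCommGroup Y] [NormedSpace ℝ Y] [NormedAddCommGroup Z] [NormedSpace ℝ Z]

theorem compLp_compLp (L : Y →L[ℝ] Z) (M : X →L[ℝ] Y) (u : Lp X 2 μ) :
    L.compLp (M.compLp u) = (L.comp M).compLp u := by
  apply Lp.ext
  filter_upwards [L.coeFn_compLp (M.compLp u), M.coeFn_compLp u, (L.comp M).coeFn_compLp u]
    with t h1 h2 h3
  rw [h1, h2, h3, ContinuousLinearMap.comp_apply]

theorem compLp_map_sub (L : X →L[ℝ] Y) (u v : Lp X 2 μ) :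
    L.compLp (u - v) = L.compLp u - L.compLp v :=
  map_sub (L.compLpL 2 μ) u v

theorem compLp_eq_self {L : X →L[ℝ] X} (hL : ∀ x, L x = x) (u : Lp X 2 μ) : L.compLp u = u := by
  apply Lp.ext
  filter_upwards [L.coeFn_compLp u] with t h1
  rw [h1, hL]

theorem norm_compLp_of_isometry {L : X →L[ℝ] Y} (hL : ∀ x, ‖L x‖ = ‖x‖) (u : Lp X 2 μ) :
    ‖L.compLp u‖ = ‖u‖ := by
  refine le_antisymm (Lp.norm_le_norm_of_ae_le ?_) (Lp.norm_le_norm_of_ae_le ?_)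
  all_goals
    filter_upwards [L.coeFn_compLp u] with t h1
    rw [h1, hL]

end CompLp

/-! ### Time-Sobolev regularity of iterated primitives -/

section TimeSobolev

variable {T : ℝ} {X : Type*} [NormedAddCommGroup X] [NormedSpace ℝ X] [CompleteSpace X]

theorem prim_pow_add (j k : ℕ) (u : TimeL2 T X) :
    (prim T X ^ j) ((prim T X ^ k) u) = (prim T X ^ (j + k)) u := by
  rw [pow_add, mul_apply_eq_comp]

theorem isWeakTimeDeriv_prim_pow (hT : 0 < T) {k l : ℕ} (hk : k ≤ l) (u : TimeL2 T X) :
    IsWeakTimeDeriv k ((prim T X ^ l) u) ((prim T X ^ (l - k)) u) := by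
  have := isWeakTimeDeriv_prim_iterate hT k ((prim T X ^ (l - k)) u)
  rwa [prim_pow_add, Nat.add_sub_of_le hk] at this

theorem memTimeSobolev_prim_pow (hT : 0 < T) (l : ℕ) (u : TimeL2 T X) :
    MemTimeSobolev l ((prim T X ^ l) u) :=
  fun _ hk => ⟨_, isWeakTimeDeriv_prim_pow hT hk u⟩

theorem memTimeSobolev_zero (u : TimeL2 T X) : MemTimeSobolev 0 u :=
  fun _ hk => ⟨u, Nat.le_zero.1 hk ▸ isWeakTimeDeriv_zero u⟩

theorem memTimeSobolev_one_prim (hT : 0 < T) (u : TimeL2 T X) :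
    MemTimeSobolev 1 (prim T X u) := by
  have := memTimeSobolev_prim_pow hT 1 u
  rwa [pow_one] at this

theorem timeSobolevNorm_zero (u : TimeL2 T X) : timeSobolevNorm 0 u = ‖u‖ := by
  simp [timeSobolevNorm, (isWeakTimeDeriv_zero u).timeDeriv_eq]

theorem timeSobolevNorm_one_le {u w : TimeL2 T X} (h : IsWeakTimeDeriv 1 u w) :
    timeSobolevNorm 1 u ≤ ‖u‖ + ‖w‖ := by
  rw [timeSobolevNorm, Finset.sum_range_succ, Finset.sum_range_one, h.timeDeriv_eq,
    (isWeakTimeDeriv_zero u).timeDeriv_eq]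
  refine Real.sqrt_le_iff.2 ⟨by positivity, ?_⟩
  nlinarith [norm_nonneg u, norm_nonneg w]

end TimeSobolev

/-! ### The parabolic problem as an operator equation -/

section Parabolic

variable {d m : ℕ} {D : Set (EuclideanSpace ℝ (Fin d))} {T : ℝ} {a : Coefficients d m}

/-- The operator on `H̊^m(D)` representing the form `∫_D u v`. -/
def massOp (D : Set (EuclideanSpace ℝ (Fin d))) (m : ℕ) : SobolevZero D m →L[ℝ] SobolevZero D m :=
  (ofDualL (SobolevZero D m)).comp (toNeg D m)

theorem inner_massOp (u v : SobolevZero D m) :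
    inner ℝ (massOp D m u) v = inner ℝ (SobolevZero.weakDeriv (MultiIndex.zero d m) u)
      (SobolevZero.weakDeriv (MultiIndex.zero d m) v) :=
  inner_ofDualL (toNeg D m u) v

theorem massOp_compLp (u : TimeL2 T (SobolevZero D m)) :
    (massOp D m).compLp u = (ofDualL (SobolevZero D m)).compLp (timeToNeg u) :=
  (compLp_compLp _ _ u).symm

theorem timeToNeg_prim_pow (k : ℕ) (u : TimeL2 T (SobolevZero D m)) :
    timeToNeg ((prim T _ ^ k) u) = (prim T _ ^ k) (timeToNeg u) :=
  (prim_pow_compLp (toNeg D m) k u).symm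

/-- The variational equation as an equation in `L_2([0,T], H̊^m(D))`. -/
theorem IsParabolic.equation_iff (ha : IsParabolic D T a) (hD : IsOpen D)
    (f w : TimeL2 T (SobolevNeg D m)) (u : TimeL2 T (SobolevZero D m)) :
    (∀ᵐ t ∂(volume.restrict (Icc 0 T)), ∀ v : SobolevZero D m,
      w t v + bilinForm a t (u t) v = f t v) ↔
    (ofDualL (SobolevZero D m)).compLp w =
      (ofDualL (SobolevZero D m)).compLp f - lpMul (formOp D T a 0) u := by
  set R := ofDualL (SobolevZero D m)
  have h : ∀ᵐ t ∂(volume.restrict (Icc 0 T)), (∀ v : SobolevZero D m,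
      w t v + bilinForm a t (u t) v = f t v) ↔
      R.compLp w t = (R.compLp f - lpMul (formOp D T a 0) u : TimeL2 T (SobolevZero D m)) t := by
    filter_upwards [R.coeFn_compLp w, R.coeFn_compLp f,
      Lp.coeFn_sub (R.compLp f) (lpMul (formOp D T a 0) u),
      coeFn_lpMul ((ha.isSmoothCoercive hD).memLp 0) u, ae_Ioo T] with t h1 h2 h3 h4 h5
    rw [h1, h3, Pi.sub_apply, h2, h4]
    refine Iff.trans (forall_congr' fun v => ?_)
      ⟨ext_inner_right ℝ, fun (h : R (w t) = _) v => congrArg (fun y => inner ℝ y v) h⟩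
    rw [inner_sub_left, inner_ofDualL, inner_ofDualL, ha.inner_formOp hD (Ioo_subset_Ioc_self h5),
      eq_sub_iff_add_eq]
  rw [Lp.ext_iff]
  exact Filter.eventually_congr h

/-- The vanishing initial value makes the embedded solution the primitive of its weak derivative, so
one integrated equation encodes both. -/
theorem IsWeakSolution.massOp_eq (ha : IsParabolic D T a) (hD : IsOpen D) (hT : 0 < T)
    {f : TimeL2 T (SobolevNeg D m)} {u : TimeL2 T (SobolevZero D m)} (h : IsWeakSolution a f u) :
    (massOp D m).compLp u = prim T _ ((ofDualL (SobolevZero D m)).compLp f -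
      lpMul (formOp D T a 0) u) := by
  have h1 := (isWeakTimeDeriv_timeDeriv (h.mem.2 1 le_rfl)).eq_prim hT h.initial
  rw [massOp_compLp, h1, ← prim_compLp, (ha.equation_iff hD _ _ _).1 h.equation]

theorem IsWeakSolution.unique (ha : IsParabolic D T a) (hD : IsOpen D) (hT : 0 < T)
    {f : TimeL2 T (SobolevNeg D m)} {u u' : TimeL2 T (SobolevZero D m)}
    (h : IsWeakSolution a f u) (h' : IsWeakSolution a f u') : u' = u := by
  refine sub_eq_zero.1 ((ha.isSmoothCoercive hD).eq_zero_of_homogeneous hT inner_massOp ?_)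
  rw [compLp_map_sub, h.massOp_eq ha hD hT, h'.massOp_eq ha hD hT, ← map_sub, ← map_add, map_sub,
    sub_sub_sub_cancel_left, sub_add_sub_cancel, sub_self, map_zero]

theorem parabolicNorm_one_le {u : TimeL2 T (SobolevZero D m)} {w : TimeL2 T (SobolevNeg D m)}
    (h : IsWeakTimeDeriv 1 (timeToNeg u) w) :
    parabolicNorm 1 u ≤ (1 + ‖toNeg D m‖) * ‖u‖ + ‖w‖ := by
  have h1 : parabolicNorm 1 u = ‖u‖ + timeSobolevNorm 1 (timeToNeg u) := by
    rw [parabolicNorm, Nat.sub_self, timeSobolevNorm_zero]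
  have h2 := timeSobolevNorm_one_le h
  have h3 : ‖timeToNeg u‖ ≤ ‖toNeg D m‖ * ‖u‖ := (toNeg D m).norm_compLp_le u
  rw [h1]
  linarith

/-- The parabolic problem for the highest time derivative. -/
theorem IsParabolic.exists_highest_derivative (ha : IsParabolic D T a) (hD : IsOpen D) (hT : 0 < T)
    (l : ℕ) : ∃ K : ℝ, 0 ≤ K ∧ ∀ f : TimeL2 T (SobolevNeg D m),
      ∃ (v : TimeL2 T (SobolevZero D m)) (w : TimeL2 T (SobolevNeg D m)),
        timeToNeg v = prim T _ w ∧
        (ofDualL (SobolevZero D m)).compLp w =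
          (ofDualL (SobolevZero D m)).compLp f - leibnizOp T (formOp D T a) l 0 v ∧
        ‖v‖ ≤ K * ‖f‖ ∧ ‖w‖ ≤ K * ‖f‖ := by
  set R := ofDualL (SobolevZero D m)
  set Q := toDualL (SobolevZero D m)
  set L := leibnizOp T (formOp D T a) l 0
  obtain ⟨μ, hμ, c, hc, hL⟩ := (ha.isSmoothCoercive hD).coercive_leibnizOp hT.le l
  set K := Real.exp (c * T) ^ 2 / μ
  have hK : 0 ≤ K := by positivity
  have hQR : ∀ y : TimeL2 T (SobolevNeg D m), Q.compLp (R.compLp y) = y := fun y => by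
    rw [compLp_compLp, compLp_eq_self]
    exact toDualL_ofDualL
  have hRQ : ∀ y : TimeL2 T (SobolevZero D m), R.compLp (Q.compLp y) = y := fun y => by
    rw [compLp_compLp, compLp_eq_self]
    exact ofDualL_toDualL
  refine ⟨K + (1 + ‖L‖ * K), by positivity, fun f => ?_⟩
  obtain ⟨v, hv, hvn⟩ := exists_solution hT.le inner_massOp L hμ hc hL (R.compLp f)
  have hf : ‖R.compLp f‖ = ‖f‖ := norm_compLp_of_isometry norm_ofDualL f
  rw [hf] at hvn
  have hLK : 0 ≤ ‖L‖ * K := by positivity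
  -- The time derivative of the embedded `v` is the residual `f - L v`, read in the dual space.
  refine ⟨v, Q.compLp (R.compLp f - L v), ?_, hRQ _, ?_, ?_⟩
  · rw [prim_compLp, ← hv, massOp_compLp, hQR]
  · exact hvn.trans (mul_le_mul_of_nonneg_right (by linarith) (norm_nonneg _))
  · rw [norm_compLp_of_isometry norm_toDualL]
    calc ‖R.compLp f - L v‖ ≤ ‖R.compLp f‖ + ‖L v‖ := norm_sub_le _ _
      _ ≤ ‖f‖ + ‖L‖ * (K * ‖f‖) := by
        rw [hf]
        gcongr
        exact (L.le_opNorm v).trans (by gcongr)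
      _ = (1 + ‖L‖ * K) * ‖f‖ := by ring
      _ ≤ _ := mul_le_mul_of_nonneg_right (by linarith) (norm_nonneg _)

end Parabolic

end ParabolicSobolev
end

/-! ### The main theorem -/

open ParabolicSobolev in
theorem mainTheorem9 (d m : ℕ) (hm : 1 ≤ m) (D : Set (EuclideanSpace ℝ (Fin d)))
    (hD : IsOpen D) (hDb : Bornology.IsBounded D) (T : ℝ) (hT : 0 < T)
    (a : Coefficients d m) (ha : IsParabolic D T a) (l : ℕ) :
    ∃ C : ℝ, 0 < C ∧ ∀ f : TimeL2 T (SobolevNeg D m),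
      MemTimeSobolev l f → (∀ k < l, VanishesAtZero (timeDeriv k f)) →
      ∃ u : TimeL2 T (SobolevZero D m), IsWeakSolution a f u ∧
        (∀ u' : TimeL2 T (SobolevZero D m), IsWeakSolution a f u' → u' = u) ∧
        MemParabolic (l + 1) u ∧
        (∀ k ≤ l, MemParabolic 1 (timeDeriv k u)) ∧
        ∑ k ∈ Finset.range (l + 1), parabolicNorm 1 (timeDeriv k u) ≤
          C * ∑ k ∈ Finset.range (l + 1), ‖timeDeriv k f‖ := by
  obtain ⟨K, hK, hsol⟩ := ha.exists_highest_derivative hD hT l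
  set S := ‖toNeg D m‖
  -- `N k` bounds the norm of `∂_t^k u = J^(l-k) v` relative to `‖fl‖`; the derivative of its
  -- embedding is `J^(l-k) w`.
  set N : ℕ → ℝ := fun k => (1 + S) * (‖prim T (SobolevZero D m) ^ (l - k)‖ * K) +
    ‖prim T (SobolevNeg D m) ^ (l - k)‖ * K with hN
  have hN0 : ∀ k, 0 ≤ N k := fun k => by positivity
  refine ⟨1 + ∑ k ∈ Finset.range (l + 1), N k,
    by have := Finset.sum_nonneg fun k (_ : k ∈ Finset.range (l + 1)) => hN0 k; positivity,
    fun f hf h0 => ?_⟩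
  set fl := timeDeriv l f with hfl
  have hfJ : f = (prim T _ ^ l) fl := timeDeriv_eq_prim_pow hT hf h0
  obtain ⟨v, w, hvw, hw, hvn, hwn⟩ := hsol fl
  have hneg : ∀ k, timeToNeg ((prim T _ ^ k) v) = prim T _ ((prim T _ ^ k) w) := fun k => by
    rw [timeToNeg_prim_pow, hvw, ← mul_apply_eq_comp, ← mul_apply_eq_comp, ← pow_succ, ← pow_succ']
  have hder : ∀ k, IsWeakTimeDeriv 1 (timeToNeg ((prim T _ ^ k) v)) ((prim T _ ^ k) w) :=
    fun k => hneg k ▸ isWeakTimeDeriv_prim hT _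
  have hmem : ∀ k, MemParabolic 1 ((prim T _ ^ k) v) := fun k =>
    ⟨memTimeSobolev_zero _, hneg k ▸ memTimeSobolev_one_prim hT _⟩
  have htime : ∀ k ≤ l, timeDeriv k ((prim T _ ^ l) v) = (prim T _ ^ (l - k)) v := fun k hk =>
    (isWeakTimeDeriv_prim_pow hT hk v).timeDeriv_eq
  have hweak : IsWeakSolution a f ((prim T _ ^ l) v) := by
    refine ⟨hmem l, hneg l ▸ vanishesAtZero_prim _, ?_⟩
    -- Applying `J^l` to the equation for `v` restores `f` and turns the memory operator back into
    -- `A J^l v`.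
    rw [(hder l).timeDeriv_eq, ha.equation_iff hD, ← prim_pow_compLp, hw, map_sub,
      prim_pow_compLp, ← hfJ, (ha.isSmoothCoercive hD).prim_pow_leibnizOp]
  refine ⟨(prim T _ ^ l) v, hweak, fun u' hu' => hweak.unique ha hD hT hu', ?_, ?_, ?_⟩
  · refine ⟨memTimeSobolev_prim_pow hT l v, ?_⟩
    rw [hneg, ← mul_apply_eq_comp, ← pow_succ']
    exact memTimeSobolev_prim_pow hT (l + 1) w
  · intro k hk
    rw [htime k hk]
    exact hmem _
  · have hsum : ‖fl‖ ≤ ∑ k ∈ Finset.range (l + 1), ‖timeDeriv k f‖ :=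
      Finset.single_le_sum (f := fun k => ‖timeDeriv k f‖) (fun _ _ => norm_nonneg _)
        (Finset.self_mem_range_succ l)
    calc ∑ k ∈ Finset.range (l + 1), parabolicNorm 1 (timeDeriv k ((prim T _ ^ l) v))
        ≤ ∑ k ∈ Finset.range (l + 1), N k * ‖fl‖ := by
          refine Finset.sum_le_sum fun k hk => ?_
          rw [htime k (Nat.lt_succ_iff.1 (Finset.mem_range.1 hk))]
          refine (parabolicNorm_one_le (hder (l - k))).trans ?_
          calc _ ≤ (1 + S) * (‖prim T (SobolevZero D m) ^ (l - k)‖ * (K * ‖fl‖)) +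
                ‖prim T (SobolevNeg D m) ^ (l - k)‖ * (K * ‖fl‖) := by
                gcongr
                · exact (ContinuousLinearMap.le_opNorm _ _).trans (by gcongr)
                · exact (ContinuousLinearMap.le_opNorm _ _).trans (by gcongr)
            _ = N k * ‖fl‖ := by rw [hN]; ring
      _ = (∑ k ∈ Finset.range (l + 1), N k) * ‖fl‖ := by rw [Finset.sum_mul]
      _ ≤ (1 + ∑ k ∈ Finset.range (l + 1), N k) * ∑ k ∈ Finset.range (l + 1), ‖timeDeriv k f‖ := by
          have := Finset.sum_nonneg fun k (_ : k ∈ Finset.range (l + 1)) => hN0 k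
          gcongr
          linarith
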